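/- **Conventions.** $\mathbb N=\{1,2,\dots\}$. A *marked group* $(G,S)$ of rank $k$ is a group $G$ with an ordered generating list $S=(s_1,\dots,s_k)$ (repetitions allowed) that is symmetric, i.e. inversion permutes the list. A sequence of marked groups $(G_n,S_n)$ of rank $k$ *converges* to $(G,S)$ (in the Chabauty topology) if for every $r$ the relations of length at most $r$ among the generators are the same in $G_n$ and in $G$ for all large $n$. A *parameter* is a real-valued function $f$ on all marked groups. It is *decreasing* if 1. $f(G/N,S')\ge f(G,S)$ for every normal subgroup $N\lhd G$, where $S'$ is the image of $S$, and 2. $(G_n,S_n)\to(G,S)$ implies $\limsup_n f(G_n,S_n)\ge f(G,S)$; it is *strictly decreasing* if moreover the inequality in 1 is strict whenever $N$ is nonamenable. *(Strictly) increasing* is defined by reversing these inequalities, and $f$ is *strictly monotone* if it is strictly decreasing or strictly increasing. **The groups $G_J$.** Consider marked groups of rank 4 with generators $a,b,c,d$ satisfying $a^2=b^2=c^2=d^2=bcd=1$. For such a group $H$ and $x\in\{0,1,2\}$ let $F_x(H)$ be the subgroup of $\mathbb Z/2\ltimes(H\oplus H)$, where the generator $\xi$ of $\mathbb Z/2$ exchanges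 the two copies of $H$, marked by its generators $$A=(\xi;1,1),\quad B=(1;\beta,b),\quad C=(1;\gamma,c),\quad D=(1;\delta,d),$$ where $(\beta,\gamma,\delta)=(a,a,1),(a,1,a),(1,a,a)$ for $x=0,1,2$ respectively. Let $\omega=x_1x_2x_3\dots=012012\dots$, and put $F^i_\omega(H)=F_{x_1}(F_{x_2}(\cdots F_{x_i}(H)\cdots))$. Let $\mathcal H\le \mathrm{PSL}(2,\mathbb Z[\mathrm i,1/2])$ be the group generated by (the classes of) $$a=\begin{pmatrix}\mathrm i&\mathrm i/4\\0&-\mathrm i\end{pmatrix},\quad b=\begin{pmatrix}0&\mathrm i\\ \mathrm i&0\end{pmatrix},\quad c=\begin{pmatrix}0&1\\-1&0\end{pmatrix},\quad d=\begin{pmatrix}\mathrm i&0\\0&-\mathrm i\end{pmatrix},$$ let $G_i=F^i_\omega(\mathcal H)$ for $i\in\mathbb N$, and let $\mathbf G_\omega$ be the Grigorchuk group of $\omega$ acting on the rooted binary tree, with its standard generators: $a$ exchanges the two subtrees below the root, and $b$, $c$, $d$ fix the vertices of the ray $111\dots$ and, for each $n\ge 0$, act on the subtree below the vertex $1^n0$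 by exchanging its two halves, except that $b$ (respectively $c$, $d$) acts trivially there if $x_{n+1}=2$ (respectively $x_{n+1}=1$, $x_{n+1}=0$). For $J\subseteq\mathbb N$ let $G_J$ be the marked product of $\mathbf G_\omega$ and all $G_i$, $i\in J$, i.e. the subgroup of the direct product $\mathbf G_\omega\times\prod_{i\in J}G_i$ generated by the four diagonally embedded generators. **Statement.** (i) For every strictly monotone parameter $f$ there is a family $\{(\Gamma_\alpha,S_\alpha)\}$ of marked groups, all of rank 4, such that the set of values $\{f(\Gamma_\alpha,S_\alpha)\}$ has the cardinality of the continuum. (ii) For every strictly decreasing (respectively strictly increasing) parameter $f$ there is a function $\mu_f:\mathbb N\to\mathbb N$ such that for every infinite set $M=\{m_1<m_2<\cdots\}\subseteq\mathbb N$ with $m_{n+1}>\mu_f(m_n)$ for all $n$, the map $J\mapsto f(G_J)$, $2^M\to\mathbb R$, is strictly decreasing (respectively strictly increasing) with respect to the lexicographic order on $2^M$, in which $J'<J''$ if and only if the least element of the symmetric difference of $J'$ and $J''$ exists and belongs to $J''$. -/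

import Mathlib

open Filter Set

noncomputable section

/-! ### Amenability -/

/-- A discrete group is amenable if it carries a left-invariant finitely additive probability
measure defined on all subsets. -/
def IsAmenableGroup (G : Type) [Group G] : Prop :=
  ∃ m : Set G → ℝ, (∀ A, 0 ≤ m A) ∧ m Set.univ = 1 ∧
    (∀ A B, Disjoint A B → m (A ∪ B) = m A + m B) ∧
    ∀ (g : G) (A : Set G), m ((fun x => g * x) '' A) = m A

/-! ### Marked groups and the Chabauty topology -/

/-- A marked group of rank `k`: a group with an ordered generating list `s_1, …, s_k` which is
symmetric, i.e. inversion permutes the list. Repetitions are allowed, so that quotients of marked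
groups are marked groups. -/
structure MarkedGroup (k : ℕ) where
  carrier : Type
  [group : Group carrier]
  gen : Fin k → carrier
  symmetric : ∃ σ : Equiv.Perm (Fin k), ∀ i, gen (σ i) = (gen i)⁻¹
  generates : Subgroup.closure (Set.range gen) = ⊤

attribute [instance] MarkedGroup.group

namespace MarkedGroup

variable {k : ℕ}

/-- The quotient `(G/N, S')`, where `S'` is the projection of `S`. -/
def quotient (G : MarkedGroup k) (N : Subgroup G.carrier) [N.Normal] : MarkedGroup k where
  carrier := G.carrier ⧸ N
  gen i := QuotientGroup.mk' N (G.gen i)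
  symmetric := by
    obtain ⟨σ, h⟩ := G.symmetric
    exact ⟨σ, fun i => by rw [h i, map_inv]⟩
  generates := by
    have h : Set.range (fun i => QuotientGroup.mk' N (G.gen i))
        = QuotientGroup.mk' N '' Set.range G.gen := by
      rw [← Set.range_comp]; rfl
    rw [h, ← MonoidHom.map_closure, G.generates, ← MonoidHom.range_eq_map,
      MonoidHom.range_eq_top]
    exact QuotientGroup.mk'_surjective N

/-- The canonical epimorphism from the free group of rank `k` onto a marked group. -/
def eval (G : MarkedGroup k) : FreeGroup (Fin k) →* G.carrier := FreeGroup.lift G.gen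

/-- Convergence of marked groups in the Chabauty topology: for every `n`, the relations of
length at most `n` of `G i` and of `L` coincide for all large `i`. -/
def Converges (G : ℕ → MarkedGroup k) (L : MarkedGroup k) : Prop :=
  ∀ n : ℕ, ∀ᶠ i in atTop, ∀ w : FreeGroup (Fin k), w.norm ≤ n →
    ((G i).eval w = 1 ↔ L.eval w = 1)

end MarkedGroup

/-! ### Monotone parameters -/

/-- A parameter: a real function on all marked groups. -/
abbrev GroupParameter : Type 1 := ∀ k : ℕ, MarkedGroup k → ℝ

namespace GroupParameter

/-- The upper limit is taken in the extended reals. -/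
def IsDecreasing (f : GroupParameter) : Prop :=
  (∀ (k : ℕ) (G : MarkedGroup k) (N : Subgroup G.carrier) [N.Normal],
    f k (G.quotient N) ≥ f k G) ∧
  (∀ (k : ℕ) (G : ℕ → MarkedGroup k) (L : MarkedGroup k), MarkedGroup.Converges G L →
    limsup (fun n => (f k (G n) : EReal)) atTop ≥ (f k L : EReal))

def IsIncreasing (f : GroupParameter) : Prop :=
  (∀ (k : ℕ) (G : MarkedGroup k) (N : Subgroup G.carrier) [N.Normal],
    f k (G.quotient N) ≤ f k G) ∧
  (∀ (k : ℕ) (G : ℕ → MarkedGroup k) (L : MarkedGroup k), MarkedGroup.Converges G L →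
    limsup (fun n => (f k (G n) : EReal)) atTop ≤ (f k L : EReal))

def IsStrictlyDecreasing (f : GroupParameter) : Prop :=
  f.IsDecreasing ∧
  ∀ (k : ℕ) (G : MarkedGroup k) (N : Subgroup G.carrier) [N.Normal],
    ¬ IsAmenableGroup N → f k (G.quotient N) > f k G

def IsStrictlyIncreasing (f : GroupParameter) : Prop :=
  f.IsIncreasing ∧
  ∀ (k : ℕ) (G : MarkedGroup k) (N : Subgroup G.carrier) [N.Normal],
    ¬ IsAmenableGroup N → f k (G.quotient N) < f k G

def IsStrictlyMonotone (f : GroupParameter) : Prop :=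
  f.IsStrictlyDecreasing ∨ f.IsStrictlyIncreasing

end GroupParameter

/-! ### Marked quotients of the free Grigorchuk group -/

/-- A marked quotient of the free Grigorchuk group
`⟨a, b, c, d ∣ a² = b² = c² = d² = bcd = 1⟩`. -/
structure GrigorchukQuotient where
  carrier : Type
  [group : Group carrier]
  a : carrier
  b : carrier
  c : carrier
  d : carrier
  a_sq : a ^ 2 = 1
  b_sq : b ^ 2 = 1
  c_sq : c ^ 2 = 1
  d_sq : d ^ 2 = 1
  bcd : b * c * d = 1
  generates : Subgroup.closure {a, b, c, d} = ⊤

attribute [instance] GrigorchukQuotient.group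

namespace GrigorchukQuotient

/-- The underlying marked group, with generating list `(a, b, c, d)`. -/
def toMarkedGroup (H : GrigorchukQuotient) : MarkedGroup 4 where
  carrier := H.carrier
  gen := ![H.a, H.b, H.c, H.d]
  symmetric := by
    refine ⟨1, fun i => ?_⟩
    have key : ∀ x : H.carrier, x ^ 2 = 1 → x = x⁻¹ := fun x hx =>
      eq_inv_of_mul_eq_one_left (by rw [← sq, hx])
    fin_cases i
    · exact key _ H.a_sq
    · exact key _ H.b_sq
    · exact key _ H.c_sq
    · exact key _ H.d_sq
  generates := by
    rw [← H.generates]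
    congr 1
    ext x
    simp
    tauto

/-- The subgroup generated by four elements that satisfy the relations, as a marked group. -/
def ofGenerators {P : Type} [Group P] (a b c d : P) (ha : a ^ 2 = 1) (hb : b ^ 2 = 1)
    (hc : c ^ 2 = 1) (hd : d ^ 2 = 1) (hbcd : b * c * d = 1) : GrigorchukQuotient where
  carrier := Subgroup.closure ({a, b, c, d} : Set P)
  a := ⟨a, Subgroup.subset_closure (by simp)⟩
  b := ⟨b, Subgroup.subset_closure (by simp)⟩
  c := ⟨c, Subgroup.subset_closure (by simp)⟩
  d := ⟨d, Subgroup.subset_closure (by simp)⟩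
  a_sq := Subtype.ext ha
  b_sq := Subtype.ext hb
  c_sq := Subtype.ext hc
  d_sq := Subtype.ext hd
  bcd := Subtype.ext hbcd
  generates := by
    rw [← Subgroup.closure_closure_coe_preimage (k := ({a, b, c, d} : Set P))]
    congr 1
    ext x
    simp [Subtype.ext_iff]

/-- The product of a family of marked groups: the subgroup of the full direct product which is
generated by the diagonally embedded generators. -/
def markedProduct {I : Type} (G : I → GrigorchukQuotient) : GrigorchukQuotient :=
  ofGenerators (P := ∀ i, (G i).carrier)
    (fun i => (G i).a) (fun i => (G i).b) (fun i => (G i).c) (fun i => (G i).d)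
    (funext fun i => (G i).a_sq) (funext fun i => (G i).b_sq) (funext fun i => (G i).c_sq)
    (funext fun i => (G i).d_sq) (funext fun i => (G i).bcd)

/-- The permutational wreath product `H ≀ ℤ/2 = ℤ/2 ⋉ (H ⊕ H)`, where `ℤ/2` is the
symmetric group on two letters, which permutes the two copies of `H`. -/
abbrev Wreath (H : Type) [Group H] : Type :=
  (Fin 2 → H) ⋊[(mulAutArrow : Equiv.Perm (Fin 2) →* MulAut (Fin 2 → H))] Equiv.Perm (Fin 2)

theorem inl_pair_sq {H : Type} [Group H] (u v : H) (hu : u ^ 2 = 1) (hv : v ^ 2 = 1) :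
    (SemidirectProduct.inl ![u, v] : Wreath H) ^ 2 = 1 := by
  rw [← map_pow, ← map_one SemidirectProduct.inl]
  congr 1
  ext j
  fin_cases j
  · simpa using hu
  · simpa using hv

open SemidirectProduct in
/-- The marked group `F_x(H)`, `x ∈ {0, 1, 2}`, generated in `H ≀ ℤ/2` by `A = (ξ; 1, 1)` and
`B = (1; β, b)`, `C = (1; γ, c)`, `D = (1; δ, d)`, where
`(β, γ, δ)` is `(a, a, 1)`, `(a, 1, a)`, `(1, a, a)` for `x = 0, 1, 2`, in this order:
so `β = 1` for `x = 2`, `γ = 1` for `x = 1`, `δ = 1` for `x = 0`. -/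
def extension (x : Fin 3) (H : GrigorchukQuotient) : GrigorchukQuotient :=
  ofGenerators (P := Wreath H.carrier)
    (inr (Equiv.swap 0 1))
    (inl ![if x = 2 then 1 else H.a, H.b])
    (inl ![if x = 1 then 1 else H.a, H.c])
    (inl ![if x = 0 then 1 else H.a, H.d])
    (by rw [← map_pow, sq, Equiv.swap_mul_self, map_one])
    (inl_pair_sq _ _ (by split_ifs <;> simp [H.a_sq]) H.b_sq)
    (inl_pair_sq _ _ (by split_ifs <;> simp [H.a_sq]) H.c_sq)
    (inl_pair_sq _ _ (by split_ifs <;> simp [H.a_sq]) H.d_sq)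
    (by
      rw [← map_mul, ← map_mul, ← map_one inl]
      congr 1
      have h : H.a * H.a = 1 := by rw [← sq, H.a_sq]
      ext j
      fin_cases j
      · fin_cases x <;> simp [h]
      · simpa using H.bcd)

/-- `F_ω^i(H) = F_{x₁}(F_{x₂}(⋯ F_{x_i}(H)⋯))`, for the infinite word `ω = x₁x₂x₃⋯`, whose
letter `x_{n+1}` is `ω n`. -/
def iterExtension : ℕ → (ℕ → Fin 3) → GrigorchukQuotient → GrigorchukQuotient
  | 0, _, H => H
  | i + 1, ω, H => extension (ω 0) (iterExtension i (fun n => ω (n + 1)) H)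

end GrigorchukQuotient

/-! ### Grigorchuk groups -/

namespace GrigorchukGroup

/-- The automorphism of the binary tree (with vertices the finite words over `Bool`) which
exchanges the two subtrees below the root. -/
def flip : List Bool → List Bool
  | [] => []
  | x :: w => (!x) :: w

/-- The directed automorphism along the ray `1 1 1 ⋯` of the binary tree: on the subtree hanging
at `1ⁿ0` it acts as `flip` if `e n` holds and trivially otherwise. -/
def directed : (ℕ → Bool) → List Bool → List Bool
  | _, [] => []
  | e, false :: w => false :: (if e 0 then flip w else w)
  | e, true :: w => true :: directed (fun n => e (n + 1)) w

theorem flip_flip (w : List Bool) : flip (flip w) = w := by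
  cases w <;> simp [flip]

theorem directed_directed (w : List Bool) : ∀ e e' : ℕ → Bool,
    directed e (directed e' w) = directed (fun n => xor (e n) (e' n)) w := by
  induction w with
  | nil => intro e e'; rfl
  | cons x w ih =>
    intro e e'
    cases x
    · cases h : e 0 <;> cases h' : e' 0 <;> simp [directed, h, h', flip_flip]
    · simp [directed, ih]

theorem directed_false (w : List Bool) : directed (fun _ => false) w = w := by
  induction w with
  | nil => rfl
  | cons x w ih => cases x <;> simp [directed, ih]

theorem directed_involutive (e : ℕ → Bool) : Function.Involutive (directed e) := fun w => by
  simp [directed_directed, directed_false]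

def flipPerm : Equiv.Perm (List Bool) := Function.Involutive.toPerm flip flip_flip

def directedPerm (e : ℕ → Bool) : Equiv.Perm (List Bool) :=
  Function.Involutive.toPerm (directed e) (directed_involutive e)

end GrigorchukGroup

open GrigorchukGroup in
/-- The Grigorchuk group of the infinite word `ω`, acting on the binary tree. Its generator `b`
acts at `1ⁿ0` by `flip` unless `ω n = 2`; likewise `c` unless `ω n = 1` and `d` unless
`ω n = 0`. -/
def grigorchukGroup (ω : ℕ → Fin 3) : GrigorchukQuotient :=
  GrigorchukQuotient.ofGenerators (P := Equiv.Perm (List Bool))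
    flipPerm
    (directedPerm fun n => decide (ω n ≠ 2))
    (directedPerm fun n => decide (ω n ≠ 1))
    (directedPerm fun n => decide (ω n ≠ 0))
    (Equiv.ext fun w => flip_flip w)
    (Equiv.ext fun w => directed_involutive _ w)
    (Equiv.ext fun w => directed_involutive _ w)
    (Equiv.ext fun w => directed_involutive _ w)
    (Equiv.ext fun w => by
      change directed _ (directed _ (directed _ w)) = w
      rw [directed_directed, directed_directed]
      convert directed_false w using 2
      ext n
      generalize ω n = x
      fin_cases x <;> rfl)

/-! ### The decorated groups -/

namespace DecoratedGroup

open Matrix Complex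

/-- The image in `PSL(2, ℂ)` of a complex matrix of determinant one. -/
def toPSL (A : Matrix (Fin 2) (Fin 2) ℂ) (h : A.det = 1) :
    ProjectiveSpecialLinearGroup (Fin 2) ℂ :=
  QuotientGroup.mk (⟨A, h⟩ : SpecialLinearGroup (Fin 2) ℂ)

theorem toPSL_sq (A : Matrix (Fin 2) (Fin 2) ℂ) (h : A.det = 1) (hA : A * A = -1) :
    toPSL A h ^ 2 = 1 := by
  have hc : (⟨A, h⟩ * ⟨A, h⟩ : SpecialLinearGroup (Fin 2) ℂ) ∈
      Subgroup.center (SpecialLinearGroup (Fin 2) ℂ) := by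
    rw [Subgroup.mem_center_iff]
    intro g
    apply Subtype.ext
    change (g : Matrix (Fin 2) (Fin 2) ℂ) * (A * A) = A * A * (g : Matrix (Fin 2) (Fin 2) ℂ)
    simp [hA]
  rw [sq]
  exact (QuotientGroup.eq_one_iff _).mpr hc

theorem toPSL_mul_mul (A B C : Matrix (Fin 2) (Fin 2) ℂ) (hA : A.det = 1) (hB : B.det = 1)
    (hC : C.det = 1) (h : A * B * C = 1) : toPSL A hA * toPSL B hB * toPSL C hC = 1 :=
  congrArg (QuotientGroup.mk' (Subgroup.center (SpecialLinearGroup (Fin 2) ℂ)))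
    (show (⟨A, hA⟩ * ⟨B, hB⟩ * ⟨C, hC⟩ : SpecialLinearGroup (Fin 2) ℂ) = 1 from Subtype.ext h)

def matA : ProjectiveSpecialLinearGroup (Fin 2) ℂ := toPSL !![I, I / 4; 0, -I] (by simp)
def matB : ProjectiveSpecialLinearGroup (Fin 2) ℂ := toPSL !![0, I; I, 0] (by simp)
def matC : ProjectiveSpecialLinearGroup (Fin 2) ℂ := toPSL !![0, 1; -1, 0] (by simp)
def matD : ProjectiveSpecialLinearGroup (Fin 2) ℂ := toPSL !![I, 0; 0, -I] (by simp)

/-- The nonamenable marked group generated by four explicit matrices with entries in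
`ℤ[i, 1/2]`. -/
def nonamenableGroup : GrigorchukQuotient :=
  GrigorchukQuotient.ofGenerators matA matB matC matD
    (toPSL_sq _ _ (by ext i j; fin_cases i <;> fin_cases j <;> simp; ring))
    (toPSL_sq _ _ (by ext i j; fin_cases i <;> fin_cases j <;> simp))
    (toPSL_sq _ _ (by ext i j; fin_cases i <;> fin_cases j <;> simp))
    (toPSL_sq _ _ (by ext i j; fin_cases i <;> fin_cases j <;> simp))
    (toPSL_mul_mul _ _ _ _ _ _ (by ext i j; fin_cases i <;> fin_cases j <;> simp))

/-- The periodic word `012012012⋯`. -/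
def word012 (n : ℕ) : Fin 3 := Fin.ofNat 3 n

/-- The marked group `F_ω^i` of the nonamenable group above, for `ω = (012)^∞`. -/
def level (i : ℕ) : GrigorchukQuotient :=
  GrigorchukQuotient.iterExtension i word012 nonamenableGroup

end DecoratedGroup

open DecoratedGroup in
/-- The decorated Grigorchuk group `G_J`: the marked product of all `level i`, `i ∈ J`, and of the
first Grigorchuk group (which is indexed by `none`). -/
def decoratedGroup (J : Set ℕ) : MarkedGroup 4 :=
  (GrigorchukQuotient.markedProduct fun o : Option J =>
    o.elim (grigorchukGroup word012) fun i => level i).toMarkedGroup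

/-- The subset of `M` with indicator function `x`. -/
def subsetOf {M : Set ℕ} (x : Lex (M → Bool)) : Set ℕ :=
  {n | ∃ h : n ∈ M, ofLex x ⟨n, h⟩ = true}

end

/-! A decreasing parameter depends only on the relations of a marked group (apply semicontinuity to
constant sequences), and it can only grow when relations are added. So $J\mapsto f(G_J)$ decreases
under inclusion, and two facts about the groups $G_J$ remain to be found.

Convergence: $G_{K\cup[n,\infty)}\to G_K$. The Grigorchuk group satisfies the same recursion on
sections of words as the extensions $F_x$, and sections of a reduced word of length at least 2 are
shorter. Hence each relation of $\mathbf G_\omega$ holds in $F^i_\omega(H)$ for all large $i$,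
whatever $H$ is (`exists_evalList_iterExtension_eq_one`).

Strictness: for $K\subseteq[0,m)$ the kernel of $G_{K\cup\{m\}}\to G_K$ is nonamenable. Its image in
the factor $G_m$ is normal, so it suffices that this image is nontrivial and that $G_m$ is "robust":
nontrivial normal subgroups are nonamenable and never commute with one another. Robustness holds for
$\mathcal H$ by ping-pong on the projective line (`nonamenableGroup_isRobust`) and passes to
extensions (`IsRobust.extension`). The image is nontrivial because non-inclusion into the relations
of a robust group survives finite intersections, as with prime ideals (`IsRobust.not_inf_le_ker`),
and because neither $\mathbf G_\omega$ nor any $G_i$ with $i<m$ has all its relations valid in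
$G_m$. The last claim descends through common extensions (`not_ker_extension_le`) to two explicit
relations.

Together, $f(G_{K\cup\{m\}})<f(G_K)\le\limsup_n f(G_{K\cup[n,\infty)})$, so
$f(G_{K\cup\{m\}})<f(G_{K\cup[n,\infty)})$ for all $n\ge\mu(m)$, uniformly over the finitely many
$K$ (`exists_gap`). If $J'<J''$ first differ at $m_j$ and $K$ is their common part below it, then
$J''\supseteq K\cup\{m_j\}$ and $J'\subseteq K\cup[m_{j+1},\infty)$, which gives strict
antitonicity. Increasing parameters are handled by negation. -/

noncomputable section

/-! ### Amenability and means -/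

/-- A map `τ : X → Y` for which every left translation of `Y` lifts to one of `X` pushes invariant
means forward. -/
theorem IsAmenableGroup.of_map {X Y : Type} [Group X] [Group Y] (hX : IsAmenableGroup X)
    (τ : X → Y) (hτ : ∀ y, ∃ x, ∀ z, τ (x * z) = y * τ z) : IsAmenableGroup Y := by
  obtain ⟨m, h0, h1, hadd, hinv⟩ := hX
  refine ⟨fun A => m (τ ⁻¹' A), fun A => h0 _, by simpa using h1,
    fun A B h => hadd _ _ (h.preimage τ), fun y A => ?_⟩
  obtain ⟨x, hx⟩ := hτ y
  have h : τ ⁻¹' ((fun z => y * z) '' A) = (fun z => x * z) '' (τ ⁻¹' A) := by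
    ext z
    constructor
    · rintro ⟨a, ha, h⟩
      refine ⟨x⁻¹ * z, ?_, by simp⟩
      have h2 := hx (x⁻¹ * z)
      rw [mul_inv_cancel_left] at h2
      have h3 : a = τ (x⁻¹ * z) := mul_left_cancel (h.trans h2)
      rwa [mem_preimage, ← h3]
    · rintro ⟨w, hw, rfl⟩
      exact ⟨τ w, hw, (hx w).symm⟩
  change m (τ ⁻¹' ((fun z => y * z) '' A)) = m (τ ⁻¹' A)
  rw [h, hinv]

theorem IsAmenableGroup.of_surjective {X Y : Type} [Group X] [Group Y] (hX : IsAmenableGroup X)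
    (φ : X →* Y) (hφ : Function.Surjective φ) : IsAmenableGroup Y :=
  hX.of_map φ fun y => by
    obtain ⟨x, rfl⟩ := hφ y
    exact ⟨x, fun z => map_mul φ x z⟩

/-- A choice of representatives for the right cosets of the image splits each element of `X` as a
factor from `Y` times a representative; the first factor is a `Y`-equivariant map, along which the
mean is pushed forward. -/
theorem IsAmenableGroup.of_injective {X Y : Type} [Group X] [Group Y] (hX : IsAmenableGroup X)
    (ι : Y →* X) (hι : Function.Injective ι) : IsAmenableGroup Y := by
  let s := QuotientGroup.rightRel ι.range
  have key : ∀ z : X, ∃ y : Y, z = ι y * (Quotient.mk s z).out := by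
    intro z
    have h : s ((Quotient.mk s z).out) z := Quotient.exact (Quotient.out_eq _)
    obtain ⟨y, hy⟩ := QuotientGroup.rightRel_apply.mp h
    exact ⟨y, by rw [hy]; group⟩
  choose τ hτ using key
  refine hX.of_map τ fun y => ⟨ι y, fun z => hι ?_⟩
  have hq : Quotient.mk s (ι y * z) = Quotient.mk s z :=
    Quotient.sound (QuotientGroup.rightRel_apply.mpr ⟨y⁻¹, by simp⟩)
  have h1 := hτ (ι y * z)
  rw [hq] at h1
  have h2 := hτ z
  have h3 : ι (τ (ι y * z)) * (Quotient.mk s z).out = ι (y * τ z) * (Quotient.mk s z).out := by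
    rw [← h1, map_mul, mul_assoc, ← h2]
  exact mul_right_cancel h3

/-- Three pairwise disjoint sets, each of which absorbs a translate of its complement, would each
have measure at least one half. -/
theorem not_isAmenableGroup_of_absorbing {X : Type} [Group X] (B : Fin 3 → Set X) (g : Fin 3 → X)
    (hB : Pairwise fun i j => Disjoint (B i) (B j)) (hg : ∀ i x, x ∉ B i → g i * x ∈ B i) :
    ¬ IsAmenableGroup X := by
  rintro ⟨m, h0, h1, hadd, hinv⟩
  have hmono : ∀ A B : Set X, A ⊆ B → m A ≤ m B := fun A B h => by
    have h2 := hadd A (B \ A) disjoint_sdiff_right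
    rw [union_sdiff_cancel h] at h2
    linarith [h0 (B \ A)]
  have half : ∀ i, 1 ≤ 2 * m (B i) := fun i => by
    have h2 := hadd (B i) (B i)ᶜ disjoint_compl_right
    rw [union_compl_self, h1] at h2
    have h3 : m (B i)ᶜ ≤ m (B i) := by
      rw [← hinv (g i)]
      refine hmono _ _ ?_
      rintro _ ⟨x, hx, rfl⟩
      exact hg i x hx
    linarith
  have h2 := hadd (B 0 ∪ B 1) (B 2)
    (disjoint_union_left.mpr ⟨hB (by decide), hB (by decide)⟩)
  rw [hadd _ _ (hB (by decide : (0 : Fin 3) ≠ 1))] at h2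
  have h3 := hmono _ _ (subset_univ (B 0 ∪ B 1 ∪ B 2))
  linarith [half 0, half 1, half 2]

/-! ### Relations of marked groups -/

namespace MarkedGroup

variable {k : ℕ}

theorem eval_surjective (G : MarkedGroup k) : Function.Surjective G.eval := by
  rw [← MonoidHom.range_eq_top, eval, FreeGroup.range_lift_eq_closure, G.generates]

theorem eval_of (G : MarkedGroup k) (i : Fin k) : G.eval (FreeGroup.of i) = G.gen i :=
  FreeGroup.lift_apply_of

theorem eval_quotient (G : MarkedGroup k) (N : Subgroup G.carrier) [N.Normal]
    (w : FreeGroup (Fin k)) : (G.quotient N).eval w = QuotientGroup.mk' N (G.eval w) := by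
  have h : (G.quotient N).eval = (QuotientGroup.mk' N).comp G.eval := by
    ext i
    exact ((G.quotient N).eval_of i).trans (congrArg (QuotientGroup.mk' N) (G.eval_of i).symm)
  exact DFunLike.congr_fun h w

/-- The epimorphism between marked groups given by an inclusion of the sets of relations. -/
theorem exists_hom {G P : MarkedGroup k} (h : G.eval.ker ≤ P.eval.ker) :
    ∃ φ : G.carrier →* P.carrier, ∀ w, φ (G.eval w) = P.eval w := by
  refine ⟨G.eval.liftOfSurjective G.eval_surjective ⟨P.eval, h⟩, fun w => ?_⟩
  exact MonoidHom.liftOfRightInverse_comp_apply _ _ _ ⟨P.eval, h⟩ w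

theorem ker_eval_quotient_map {G L : MarkedGroup k} (h : G.eval.ker ≤ L.eval.ker)
    [(L.eval.ker.map G.eval).Normal] :
    (G.quotient (L.eval.ker.map G.eval)).eval.ker = L.eval.ker := by
  ext w
  rw [MonoidHom.mem_ker, eval_quotient]
  refine (QuotientGroup.eq_one_iff _).trans ?_
  constructor
  · rintro ⟨v, hv, hvw⟩
    have h1 : v⁻¹ * w ∈ L.eval.ker := h (by rw [MonoidHom.mem_ker, map_mul, map_inv, hvw]; simp)
    simpa using mul_mem hv h1
  · exact fun hw => ⟨w, hw, rfl⟩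

end MarkedGroup

/-! ### Parameters as functions of the set of relations -/

namespace GroupParameter

open MarkedGroup

variable {f : GroupParameter} {k : ℕ}

/-- Invariance under isomorphism is not an axiom for parameters. It follows from semicontinuity,
since a constant sequence converges to every marked group with the same relations. -/
theorem IsDecreasing.eq_of_ker_eq (hf : f.IsDecreasing) {G L : MarkedGroup k}
    (h : G.eval.ker = L.eval.ker) : f k G = f k L := by
  have key : ∀ {G L : MarkedGroup k}, G.eval.ker = L.eval.ker → f k L ≤ f k G := by
    intro G L h
    have h1 := hf.2 k (fun _ => G) L fun n => Eventually.of_forall fun i w _ => by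
      rw [← MonoidHom.mem_ker, ← MonoidHom.mem_ker, h]
    simpa using h1
  exact le_antisymm (key h.symm) (key h)

theorem normal_map_ker (G L : MarkedGroup k) : (L.eval.ker.map G.eval).Normal :=
  Subgroup.Normal.map inferInstance _ G.eval_surjective

theorem IsDecreasing.le_of_ker_le (hf : f.IsDecreasing) {G L : MarkedGroup k}
    (h : G.eval.ker ≤ L.eval.ker) : f k G ≤ f k L := by
  have := normal_map_ker G L
  rw [← hf.eq_of_ker_eq (ker_eval_quotient_map h)]
  exact hf.1 k G _

/-- A parameter drops strictly if some other quotient `P` of `G` has only nonamenable nontrivial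
normal subgroups and the relations of `L` do not all hold in `P`. -/
theorem IsStrictlyDecreasing.lt_of_ker_le (hf : f.IsStrictlyDecreasing) {G L P : MarkedGroup k}
    (h : G.eval.ker ≤ L.eval.ker) (hP : G.eval.ker ≤ P.eval.ker)
    (hna : ∀ N : Subgroup P.carrier, N.Normal → N ≠ ⊥ → ¬ IsAmenableGroup N)
    (hLP : ¬ L.eval.ker ≤ P.eval.ker) : f k G < f k L := by
  have := normal_map_ker G L
  rw [← hf.1.eq_of_ker_eq (ker_eval_quotient_map h)]
  -- If the kernel of `G → L` were amenable, so would be its image in `P`. That image is normal, and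
  -- nontrivial because some relation of `L` fails in `P`.
  refine hf.2 k G _ fun ham => ?_
  refine hna (L.eval.ker.map P.eval) (normal_map_ker P L)
    (fun hbot => hLP ((Subgroup.map_eq_bot_iff _).mp hbot)) ?_
  obtain ⟨φ, hφ⟩ := exists_hom hP
  refine ham.of_surjective
    ((φ.comp (L.eval.ker.map G.eval).subtype).codRestrict (L.eval.ker.map P.eval) ?_) ?_
  · rintro ⟨_, w, hw, rfl⟩
    exact ⟨w, hw, (hφ w).symm⟩
  · rintro ⟨_, w, hw, rfl⟩
    exact ⟨⟨_, w, hw, rfl⟩, Subtype.ext (hφ w)⟩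

/-- Negation turns limsup into liminf, so only the weaker bound on the liminf is used. -/
theorem IsStrictlyIncreasing.neg (hf : f.IsStrictlyIncreasing) :
    IsStrictlyDecreasing fun k G => - f k G := by
  refine ⟨⟨fun k G N _ => neg_le_neg (hf.1.1 k G N), fun k G L h => ?_⟩,
    fun k G N _ hN => neg_lt_neg (hf.2 k G N hN)⟩
  have h1 := hf.1.2 k G L h
  have h2 : liminf (fun n => (f k (G n) : EReal)) atTop ≤ f k L := (liminf_le_limsup).trans h1
  have h3 : limsup (fun n => ((- f k (G n) : ℝ) : EReal)) atTop
      = - liminf (fun n => (f k (G n) : EReal)) atTop := by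
    simp only [EReal.coe_neg]
    exact EReal.limsup_neg
  rw [ge_iff_le, h3, EReal.coe_neg, EReal.neg_le_neg_iff]
  exact h2

end GroupParameter

/-! ### Sections of words -/

namespace GrigorchukQuotient

/-- Evaluation of words of the free group in a marked quotient of the free Grigorchuk group. -/
abbrev ev (H : GrigorchukQuotient) : FreeGroup (Fin 4) →* H.carrier := H.toMarkedGroup.eval

/-- The generators `a, b, c, d`, numbered from `0` to `3`. -/
def letter (H : GrigorchukQuotient) : Fin 4 → H.carrier := ![H.a, H.b, H.c, H.d]

theorem ev_of (H : GrigorchukQuotient) (s : Fin 4) : H.ev (FreeGroup.of s) = H.letter s :=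
  H.toMarkedGroup.eval_of s

theorem letter_mul_self (H : GrigorchukQuotient) (s : Fin 4) : H.letter s * H.letter s = 1 := by
  rw [← sq]
  fin_cases s
  · exact H.a_sq
  · exact H.b_sq
  · exact H.c_sq
  · exact H.d_sq

theorem letter_inv (H : GrigorchukQuotient) (s : Fin 4) : (H.letter s)⁻¹ = H.letter s :=
  inv_eq_of_mul_eq_one_left (H.letter_mul_self s)

/-- Evaluation of positive words. -/
def evalList (H : GrigorchukQuotient) (l : List (Fin 4)) : H.carrier := (l.map H.letter).prod

@[simp] theorem evalList_nil (H : GrigorchukQuotient) : H.evalList [] = 1 := rfl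

@[simp] theorem evalList_cons (H : GrigorchukQuotient) (s : Fin 4) (l : List (Fin 4)) :
    H.evalList (s :: l) = H.letter s * H.evalList l := by simp [evalList]

theorem ev_mk (H : GrigorchukQuotient) (L : List (Fin 4 × Bool)) :
    H.ev (FreeGroup.mk L) = H.evalList (L.map Prod.fst) := by
  induction L with
  | nil => exact map_one _
  | cons p L ih =>
    obtain ⟨s, b⟩ := p
    have h : (FreeGroup.mk ((s, b) :: L) : FreeGroup (Fin 4))
        = FreeGroup.mk [(s, b)] * FreeGroup.mk L := by simp
    have h2 : H.ev (FreeGroup.mk [(s, b)]) = H.letter s := by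
      cases b
      · rw [← letter_inv, ← H.ev_of, ← map_inv]
        congr 1
      · exact H.ev_of s
    rw [h, map_mul, ih, h2, List.map_cons, evalList_cons]

/-- The index of the generator of `F_x(H)` that has a trivial first coordinate. -/
def dead (x : Fin 3) : Fin 4 := ![3, 2, 1] x

/-- Whether a word contains an odd number of letters `a`. -/
def parity : List (Fin 4) → Bool
  | [] => false
  | s :: l => if s = 0 then !parity l else parity l

/-- The two sections of a word. -/
def wordSection (x : Fin 3) : List (Fin 4) → Bool → List (Fin 4)
  | [], _ => []
  | s :: l, y =>
    if s = 0 then wordSection x l (!y)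
    else if y then s :: wordSection x l y
    else if s = dead x then wordSection x l y else 0 :: wordSection x l y

open SemidirectProduct

/-- The inclusion of `F_x(H)` into the wreath product. -/
def toWreath (x : Fin 3) (H : GrigorchukQuotient) :
    (extension x H).carrier →* Wreath H.carrier := Subgroup.subtype _

theorem toWreath_injective (x : Fin 3) (H : GrigorchukQuotient) :
    Function.Injective (toWreath x H) := Subtype.val_injective

theorem toWreath_a (x : Fin 3) (H : GrigorchukQuotient) :
    toWreath x H ((extension x H).letter 0) = inr (Equiv.swap 0 1) := rfl

theorem toWreath_letter (x : Fin 3) (H : GrigorchukQuotient) (s : Fin 4) (hs : s ≠ 0) :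
    toWreath x H ((extension x H).letter s)
      = inl ![if s = dead x then 1 else H.a, H.letter s] := by
  fin_cases s
  · exact absurd rfl hs
  all_goals fin_cases x <;> rfl

theorem inr_swap_mul_inl {G : Type} [Group G] (u v : G) :
    (inr (Equiv.swap 0 1) * inl ![u, v] : Wreath G) = inl ![v, u] * inr (Equiv.swap 0 1) := by
  refine SemidirectProduct.ext (funext fun j => ?_) ?_
  · fin_cases j
    · exact (one_mul v).trans (mul_one v).symm
    · exact (one_mul u).trans (mul_one u).symm
  · simp

theorem inl_mul_inl {G : Type} [Group G] (u v u' v' : G) :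
    (inl ![u, v] * inl ![u', v'] : Wreath G) = inl ![u * u', v * v'] := by
  rw [← map_mul]
  congr 1
  ext j
  fin_cases j <;> rfl

/-- The base group stands to the left of the permutation, so that sections are indexed by the
coordinate at which a word arrives, not by the one from which it starts. -/
theorem toWreath_evalList (x : Fin 3) (H : GrigorchukQuotient) (l : List (Fin 4)) :
    toWreath x H ((extension x H).evalList l)
      = inl ![H.evalList (wordSection x l false), H.evalList (wordSection x l true)]
        * inr (if parity l then Equiv.swap 0 1 else 1) := by
  induction l with
  | nil =>
    have h : (![1, 1] : Fin 2 → H.carrier) = 1 := by ext j; fin_cases j <;> rfl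
    simp [wordSection, parity, h]
  | cons s l ih =>
    rw [evalList_cons, map_mul, ih]
    by_cases hs : s = 0
    · subst hs
      rw [toWreath_a, ← mul_assoc, inr_swap_mul_inl, mul_assoc, ← map_mul]
      cases h : parity l <;> simp [wordSection, parity, h]
    · rw [toWreath_letter x H s hs, ← mul_assoc, inl_mul_inl]
      by_cases hd : s = dead x
      · subst hd
        simp [wordSection, parity, hs]
      · have h0 : H.letter 0 = H.a := rfl
        simp [wordSection, parity, hs, hd, h0]

theorem inl_mul_inr_eq_one {G : Type} [Group G] (u v : G) (π : Bool) :
    (inl ![u, v] * inr (if π then Equiv.swap 0 1 else 1) : Wreath G) = 1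
      ↔ π = false ∧ u = 1 ∧ v = 1 := by
  constructor
  · intro h
    have hl : ![u, v] = 1 := by simpa using congrArg SemidirectProduct.left h
    have hr : (if π then Equiv.swap (0 : Fin 2) 1 else 1) = 1 := by
      simpa using congrArg SemidirectProduct.right h
    refine ⟨?_, congrFun hl 0, congrFun hl 1⟩
    cases π
    · rfl
    · exact absurd hr (by decide)
  · rintro ⟨rfl, rfl, rfl⟩
    have h : (![1, 1] : Fin 2 → G) = 1 := by ext j; fin_cases j <;> rfl
    simp [h]

theorem evalList_extension_eq_one (x : Fin 3) (H : GrigorchukQuotient) (l : List (Fin 4)) :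
    (extension x H).evalList l = 1 ↔
      parity l = false ∧ ∀ y, H.evalList (wordSection x l y) = 1 := by
  rw [← (toWreath_injective x H).eq_iff, map_one, toWreath_evalList, inl_mul_inr_eq_one,
    Bool.forall_bool]

end GrigorchukQuotient

open GrigorchukQuotient GrigorchukGroup

/-! ### Sections in Grigorchuk groups -/

/-- The action of a Grigorchuk group on the binary tree. -/
def treeAction (ω : ℕ → Fin 3) : (grigorchukGroup ω).carrier →* Equiv.Perm (List Bool) :=
  Subgroup.subtype _

theorem treeAction_injective (ω : ℕ → Fin 3) : Function.Injective (treeAction ω) :=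
  Subtype.val_injective

theorem treeAction_a (ω : ℕ → Fin 3) (w : List Bool) :
    treeAction ω ((grigorchukGroup ω).letter 0) w = GrigorchukGroup.flip w := rfl

theorem treeAction_letter (ω : ℕ → Fin 3) (s : Fin 4) (hs : s ≠ 0) (w : List Bool) :
    treeAction ω ((grigorchukGroup ω).letter s) w
      = directed (fun n => decide (s ≠ dead (ω n))) w := by
  fin_cases s
  · exact absurd rfl hs
  all_goals
    change directed _ w = directed _ w
    congr 1
    funext n
    generalize ω n = x
    fin_cases x <;> rfl

theorem treeAction_evalList_nil (ω : ℕ → Fin 3) (l : List (Fin 4)) :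
    treeAction ω ((grigorchukGroup ω).evalList l) [] = [] := by
  induction l with
  | nil => rw [evalList_nil, map_one]; rfl
  | cons s l ih =>
    rw [evalList_cons, map_mul, Equiv.Perm.mul_apply, ih]
    by_cases hs : s = 0
    · subst hs; rfl
    · rw [treeAction_letter ω s hs]; rfl

theorem treeAction_evalList_cons (ω : ℕ → Fin 3) (l : List (Fin 4)) (y : Bool) (w : List Bool) :
    treeAction ω ((grigorchukGroup ω).evalList l) (y :: w)
      = (parity l ^^ y) :: treeAction (fun n => ω (n + 1))
          ((grigorchukGroup fun n => ω (n + 1)).evalList (wordSection (ω 0) l (parity l ^^ y))) w := by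
  induction l with
  | nil => simp [parity, wordSection]
  | cons s l ih =>
    rw [evalList_cons, map_mul, Equiv.Perm.mul_apply, ih]
    by_cases hs : s = 0
    · subst hs
      rw [treeAction_a, GrigorchukGroup.flip]
      simp [parity, wordSection]
    · rw [treeAction_letter ω s hs]
      have hp : parity (s :: l) = parity l := by simp [parity, hs]
      rw [hp]
      cases h : (parity l ^^ y)
      · by_cases hd : s = dead (ω 0)
        · subst hd
          simp [directed, wordSection, hs]
        · simp only [directed, wordSection, hs, hd]
          simp [treeAction_a, hd]
      · simp only [directed, wordSection, hs]
        simp [treeAction_letter _ s hs]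

theorem evalList_grigorchukGroup_eq_one (ω : ℕ → Fin 3) (l : List (Fin 4)) :
    (grigorchukGroup ω).evalList l = 1 ↔ parity l = false ∧
      ∀ y, (grigorchukGroup fun n => ω (n + 1)).evalList (wordSection (ω 0) l y) = 1 := by
  have hone : ∀ ω l, (grigorchukGroup ω).evalList l = 1 ↔
      ∀ w, treeAction ω ((grigorchukGroup ω).evalList l) w = w := fun ω l => by
    rw [← (treeAction_injective ω).eq_iff, map_one, Equiv.ext_iff]; rfl
  rw [hone]
  simp only [hone]
  constructor
  · intro h
    have hp : parity l = false := by
      have h1 := h [false]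
      rw [treeAction_evalList_cons] at h1
      simpa using (List.cons_eq_cons.mp h1).1
    refine ⟨hp, fun y w => ?_⟩
    have h1 := h (y :: w)
    rw [treeAction_evalList_cons, hp, Bool.false_xor] at h1
    exact (List.cons_eq_cons.mp h1).2
  · rintro ⟨hp, h⟩ (_ | ⟨y, w⟩)
    · exact treeAction_evalList_nil ω l
    · rw [treeAction_evalList_cons, hp, Bool.false_xor, h]

/-- Triviality of a word obeys one and the same criterion on both sides: even parity and trivial
sections over the shifted sequence. -/
theorem ker_ev_grigorchukGroup (ω : ℕ → Fin 3) :
    (grigorchukGroup ω).ev.ker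
      = (extension (ω 0) (grigorchukGroup fun n => ω (n + 1))).ev.ker := by
  ext w
  rw [MonoidHom.mem_ker, MonoidHom.mem_ker, ← FreeGroup.mk_toWord (x := w), ev_mk, ev_mk,
    evalList_grigorchukGroup_eq_one, evalList_extension_eq_one]

/-! ### Contraction -/

namespace GrigorchukQuotient

theorem dead_ne_zero (x : Fin 3) : dead x ≠ 0 := by revert x; decide

theorem dead_injective : Function.Injective dead := by decide

theorem exists_dead_eq {s : Fin 4} (hs : s ≠ 0) : ∃ x, dead x = s := by revert s; decide

theorem letter_mul_letter {s t : Fin 4} (hs : s ≠ 0) (ht : t ≠ 0) (hst : s ≠ t) :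
    ∃ r : Fin 4, r ≠ 0 ∧ ∀ H : GrigorchukQuotient, H.letter s * H.letter t = H.letter r := by
  have key : ∀ H : GrigorchukQuotient, H.b * H.c = H.d := fun H =>
    (eq_inv_of_mul_eq_one_left H.bcd).trans (H.letter_inv 3)
  have hb : ∀ H : GrigorchukQuotient, H.b * H.b = 1 := fun H => H.letter_mul_self 1
  have hc : ∀ H : GrigorchukQuotient, H.c * H.c = 1 := fun H => H.letter_mul_self 2
  have key' : ∀ H : GrigorchukQuotient, H.c * H.b = H.d := fun H => by
    have h := congrArg (·⁻¹) (key H)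
    simp only [mul_inv_rev] at h
    exact (congrArg₂ _ (H.letter_inv 2).symm (H.letter_inv 1).symm).trans
      (h.trans (H.letter_inv 3))
  have cases6 : s = 1 ∧ t = 2 ∨ s = 1 ∧ t = 3 ∨ s = 2 ∧ t = 1 ∨ s = 2 ∧ t = 3 ∨ s = 3 ∧ t = 1 ∨
      s = 3 ∧ t = 2 := by
    revert s t; decide
  rcases cases6 with ⟨rfl, rfl⟩ | ⟨rfl, rfl⟩ | ⟨rfl, rfl⟩ | ⟨rfl, rfl⟩ | ⟨rfl, rfl⟩ | ⟨rfl, rfl⟩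
  · exact ⟨3, by decide, key⟩
  · refine ⟨2, by decide, fun H => ?_⟩
    change H.b * H.d = H.c
    rw [← key, ← mul_assoc, hb, one_mul]
  · exact ⟨3, by decide, key'⟩
  · refine ⟨1, by decide, fun H => ?_⟩
    change H.c * H.d = H.b
    rw [← key', ← mul_assoc, hc, one_mul]
  · refine ⟨2, by decide, fun H => ?_⟩
    change H.d * H.b = H.c
    rw [← key', mul_assoc, hb, mul_one]
  · refine ⟨1, by decide, fun H => ?_⟩
    change H.d * H.c = H.b
    rw [← key, mul_assoc, hc, mul_one]

/-- Words in which `a` alternates with the other letters. -/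
def IsAlternating (l : List (Fin 4)) : Prop := l.IsChain fun s t => s = 0 ↔ t ≠ 0

theorem exists_isAlternating (l : List (Fin 4)) : ∃ l' : List (Fin 4), IsAlternating l' ∧
    l'.length ≤ l.length ∧ ∀ H : GrigorchukQuotient, H.evalList l' = H.evalList l := by
  induction l with
  | nil => exact ⟨[], List.isChain_nil, le_rfl, fun _ => rfl⟩
  | cons s l ih =>
    obtain ⟨l', halt, hlen, hev⟩ := ih
    rcases l' with _ | ⟨t, l'⟩
    · exact ⟨[s], List.isChain_singleton s, by simp, fun H => by
        rw [evalList_cons, evalList_cons, hev]⟩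
    by_cases hR : s = 0 ↔ t ≠ 0
    · exact ⟨s :: t :: l', List.isChain_cons_cons.mpr ⟨hR, halt⟩, by simpa using hlen,
        fun H => by rw [evalList_cons, evalList_cons _ s l, hev]⟩
    have hlen' : l'.length + 1 ≤ l.length := by simpa using hlen
    by_cases hst : s = t
    · refine ⟨l', halt.tail, by simp; omega, fun H => ?_⟩
      rw [evalList_cons, ← hev, evalList_cons, ← mul_assoc, hst, letter_mul_self, one_mul]
    · have hs : s ≠ 0 := fun h => hR (iff_of_true h fun h' => hst (h.trans h'.symm))
      have ht : t ≠ 0 := fun h => hR (iff_of_false hs (not_not.mpr h))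
      obtain ⟨r, hr, hmul⟩ := letter_mul_letter hs ht hst
      refine ⟨r :: l', ?_, by simp; omega, fun H => ?_⟩
      · rcases l' with _ | ⟨t', l'⟩
        · exact List.isChain_singleton r
        · have h := List.isChain_cons_cons.mp halt
          exact List.isChain_cons_cons.mpr
            ⟨(iff_of_false hr fun h' => ht (h.1.mpr h')), h.2⟩
      · rw [evalList_cons, evalList_cons, ← hev, evalList_cons, ← mul_assoc, hmul]

/-- A letter `a` only switches the coordinate; any other letter contributes at most one letter to
each section. -/
theorem length_section_le (x : Fin 3) (l : List (Fin 4)) (y : Bool) :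
    (wordSection x l y).length ≤ l.countP (· ≠ 0) := by
  induction l generalizing y with
  | nil => simp [wordSection]
  | cons s l ih =>
    have h := ih y
    have h' := ih (!y)
    by_cases hs : s = 0
    · subst hs
      simpa [wordSection] using h'
    · rw [List.countP_cons_of_pos (by simpa using hs), wordSection, if_neg hs]
      split_ifs <;> first | omega | (rw [List.length_cons]; omega)

/-- The sharper bound for words that begin with `a` is there to carry the induction. -/
theorem IsAlternating.two_mul_countP_le {l : List (Fin 4)} (h : IsAlternating l) :
    2 * l.countP (· ≠ 0) ≤ l.length + 1 ∧
      (l.head? = some 0 → 2 * l.countP (· ≠ 0) ≤ l.length) := by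
  induction l with
  | nil => simp
  | cons s l ih =>
    obtain ⟨ih1, ih2⟩ := ih h.tail
    by_cases hs : s = 0
    · subst hs
      simp only [ne_eq, List.length_cons] at *
      rw [List.countP_cons_of_neg (by simp)]
      exact ⟨by omega, fun _ => by omega⟩
    · refine ⟨?_, fun h0 => absurd (by simpa using h0) hs⟩
      rw [List.countP_cons_of_pos (by simpa using hs), List.length_cons]
      rcases l with _ | ⟨t, l⟩
      · simp
      · have ht : t = 0 := by
          by_contra ht
          exact hs ((List.isChain_cons_cons.mp h).1.mpr ht)
        have := ih2 (by simp [ht])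
        omega

end GrigorchukQuotient

open GrigorchukQuotient GrigorchukGroup

theorem directed_replicate (e : ℕ → Bool) (n : ℕ) (w : List Bool) :
    directed e (List.replicate n true ++ false :: w)
      = List.replicate n true ++ false :: (if e n then GrigorchukGroup.flip w else w) := by
  induction n generalizing e with
  | zero => rfl
  | succ n ih => simp [List.replicate_succ, directed, ih]

theorem grigorchukGroup_letter_ne_one {ω : ℕ → Fin 3} (hω : ∀ x, ∃ n, ω n ≠ x) (s : Fin 4) :
    (grigorchukGroup ω).letter s ≠ 1 := by
  intro h
  by_cases hs : s = 0
  · subst hs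
    have h1 := treeAction_a ω [false]
    rw [h, map_one] at h1
    exact absurd h1 (by decide)
  · obtain ⟨x, rfl⟩ : ∃ x, dead x = s := exists_dead_eq hs
    obtain ⟨n, hn⟩ := hω x
    have hd : dead x ≠ dead (ω n) := fun h => hn (dead_injective h).symm
    have h1 := treeAction_letter ω _ hs (List.replicate n true ++ [false, false])
    rw [h, map_one, directed_replicate] at h1
    simp [hd, GrigorchukGroup.flip] at h1

theorem exists_evalList_iterExtension_eq_one (n : ℕ) : ∀ (l : List (Fin 4)) (ω : ℕ → Fin 3),
    l.length ≤ n → (∀ k x, ∃ n, ω (n + k) ≠ x) → (grigorchukGroup ω).evalList l = 1 →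
    ∃ i₀, ∀ i ≥ i₀, ∀ H, (iterExtension i ω H).evalList l = 1 := by
  induction n using Nat.strong_induction_on with
  | _ n ih =>
  intro l ω hl hω h
  obtain ⟨l', halt, hlen, hev⟩ := exists_isAlternating l
  simp only [← hev] at h ⊢
  -- The bound (length + 1)/2 on sections is a strict decrease only from length 2 on. A word of
  -- length 1 is never a relation, because `ω` is not constant.
  rcases l' with _ | ⟨s, _ | ⟨t, l'⟩⟩
  · exact ⟨0, fun _ _ _ => rfl⟩
  · rw [evalList_cons, evalList_nil, mul_one] at h
    exact absurd h (grigorchukGroup_letter_ne_one (hω 0) s)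
  set l'' := s :: t :: l'
  have h2 : 2 ≤ l''.length := by simp [l'']
  obtain ⟨hp, hsec⟩ := (evalList_grigorchukGroup_eq_one ω l'').mp h
  have key : ∀ y, ∃ i₀, ∀ i ≥ i₀, ∀ H,
      (iterExtension i (fun n => ω (n + 1)) H).evalList (wordSection (ω 0) l'' y) = 1 := fun y => by
    have h3 := length_section_le (ω 0) l'' y
    have h4 := halt.two_mul_countP_le.1
    refine ih (wordSection (ω 0) l'' y).length (by omega) _ _ le_rfl (fun k x => ?_) (hsec y)
    obtain ⟨n, hn⟩ := hω (k + 1) x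
    exact ⟨n, by simpa [add_assoc] using hn⟩
  choose j hj using key
  refine ⟨max (j false) (j true) + 1, fun i hi H => ?_⟩
  obtain ⟨i, rfl⟩ : ∃ i', i = i' + 1 := ⟨i - 1, by omega⟩
  refine (evalList_extension_eq_one _ _ _).mpr ⟨hp, fun y => hj y i ?_ H⟩
  cases y
  · exact (le_max_left _ _).trans (Nat.le_of_succ_le_succ hi)
  · exact (le_max_right _ _).trans (Nat.le_of_succ_le_succ hi)

theorem eventually_ker_grigorchukGroup {ω : ℕ → Fin 3} (hω : ∀ k x, ∃ n, ω (n + k) ≠ x)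
    (H : GrigorchukQuotient) (r : ℕ) :
    ∀ᶠ i in atTop, ∀ w : FreeGroup (Fin 4), w.norm ≤ r → w ∈ (grigorchukGroup ω).ev.ker →
      w ∈ (iterExtension i ω H).ev.ker := by
  have hfin : {w : FreeGroup (Fin 4) | w.norm ≤ r}.Finite :=
    (List.finite_length_le (Fin 4 × Bool) r).preimage FreeGroup.toWord_injective.injOn
  refine (eventually_all_finite hfin).mpr fun w _ => ?_
  by_cases hw : w ∈ (grigorchukGroup ω).ev.ker
  · rw [MonoidHom.mem_ker, ← FreeGroup.mk_toWord (x := w), ev_mk] at hw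
    obtain ⟨i₀, h⟩ := exists_evalList_iterExtension_eq_one _ _ ω le_rfl hω hw
    filter_upwards [eventually_ge_atTop i₀] with i hi _
    rw [MonoidHom.mem_ker, ← FreeGroup.mk_toWord (x := w), ev_mk]
    exact h i hi H
  · exact Eventually.of_forall fun _ h => absurd h hw

/-! ### Groups whose normal subgroups are large -/

namespace GrigorchukQuotient

open SemidirectProduct

/-- The nontrivial normal subgroups are nonamenable and no two of them commute. -/
structure IsRobust (H : GrigorchukQuotient) : Prop where
  not_amenable : ∀ X : Subgroup H.carrier, X.Normal → X ≠ ⊥ → ¬ IsAmenableGroup X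
  not_commute : ∀ X Y : Subgroup H.carrier, X.Normal → Y.Normal → X ≠ ⊥ → Y ≠ ⊥ →
    ∃ x ∈ X, ∃ y ∈ Y, x * y ≠ y * x
  letter_ne_one : ∀ s, s ≠ 0 → H.letter s ≠ 1

theorem IsRobust.exists_not_commute {H : GrigorchukQuotient} (hH : H.IsRobust)
    {X : Subgroup H.carrier} (hX : X.Normal) (hX' : X ≠ ⊥) {v : H.carrier} (hv : v ≠ 1) :
    ∃ x ∈ X, v * x ≠ x * v := by
  by_contra! h
  obtain ⟨x, hx, y, hy, hxy⟩ := hH.not_commute X (Subgroup.normalClosure {v}) hX inferInstance hX'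
    fun hbot => hv (by
      have : v ∈ Subgroup.normalClosure {v} := Subgroup.subset_normalClosure rfl
      rwa [hbot, Subgroup.mem_bot] at this)
  -- The centralizer of a normal subgroup is normal, so it contains the normal closure of each of
  -- its elements.
  have hle : Subgroup.normalClosure {v} ≤ Subgroup.centralizer (X : Set H.carrier) :=
    Subgroup.normalClosure_le_normal (by
      rintro _ rfl
      exact Subgroup.mem_centralizer_iff.mpr fun x hx => (h x hx).symm)
  exact hxy (Subgroup.mem_centralizer_iff.mp (hle hy) x hx)

/-- Words which avoid the relations of a robust group are closed under intersection. -/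
theorem IsRobust.not_inf_le_ker {P : GrigorchukQuotient} (hP : P.IsRobust)
    {N₁ N₂ : Subgroup (FreeGroup (Fin 4))} (h₁ : N₁.Normal) (h₂ : N₂.Normal)
    (hN₁ : ¬ N₁ ≤ P.ev.ker) (hN₂ : ¬ N₂ ≤ P.ev.ker) : ¬ N₁ ⊓ N₂ ≤ P.ev.ker := by
  intro hle
  have hs : Function.Surjective P.ev := P.toMarkedGroup.eval_surjective
  obtain ⟨_, ⟨x, hx, rfl⟩, _, ⟨y, hy, rfl⟩, hxy⟩ := hP.not_commute (N₁.map P.ev) (N₂.map P.ev)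
    (h₁.map _ hs) (h₂.map _ hs) (fun h => hN₁ ((Subgroup.map_eq_bot_iff _).mp h))
    (fun h => hN₂ ((Subgroup.map_eq_bot_iff _).mp h))
  -- A commutator of elements of two normal subgroups lies in both.
  have hmem : x * y * x⁻¹ * y⁻¹ ∈ N₁ ⊓ N₂ := by
    refine ⟨?_, N₂.mul_mem (h₂.conj_mem y hy x) (N₂.inv_mem hy)⟩
    have h := N₁.mul_mem hx (h₁.conj_mem _ (N₁.inv_mem hx) y)
    simpa [mul_assoc] using h
  have h := hle hmem
  rw [MonoidHom.mem_ker, map_mul, map_mul, map_mul, map_inv, map_inv, mul_inv_eq_one,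
    mul_inv_eq_iff_eq_mul] at h
  exact hxy h

theorem IsRobust.not_iInf_le_ker {P : GrigorchukQuotient} (hP : P.IsRobust) {I : Type}
    (F : Finset I) (N : I → Subgroup (FreeGroup (Fin 4))) (hN : ∀ i, (N i).Normal)
    (h : ∀ i ∈ F, ¬ N i ≤ P.ev.ker) : ¬ ⨅ i ∈ F, N i ≤ P.ev.ker := by
  classical
  induction F using Finset.induction_on with
  | empty =>
    intro hle
    have h1 : FreeGroup.of (1 : Fin 4) ∈ P.ev.ker := hle (by simp)
    rw [MonoidHom.mem_ker, ev_of] at h1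
    exact hP.letter_ne_one 1 (by decide) h1
  | insert i F _ ih =>
    rw [Finset.iInf_insert]
    refine hP.not_inf_le_ker (hN i) ?_ (h i (Finset.mem_insert_self i F))
      (ih fun j hj => h j (Finset.mem_insert_of_mem hj))
    exact Subgroup.normal_iInf_normal fun i => Subgroup.normal_iInf_normal fun _ => hN i

/-! ### Extensions of robust groups -/

theorem inl_pair_inv {G : Type} [Group G] (u v : G) :
    (inl ![u, v] : Wreath G)⁻¹ = inl ![u⁻¹, v⁻¹] := by
  rw [← map_inv]
  congr 1
  ext j
  fin_cases j <;> rfl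

theorem inl_one_one {G : Type} [Group G] : (inl ![1, 1] : Wreath G) = 1 := by
  rw [← map_one inl]
  congr 1
  ext j
  fin_cases j <;> rfl

/-- The embedding of the second copy of a group into its wreath product with `ℤ/2`. -/
def secondCopy (G : Type) [Group G] : G →* Wreath G where
  toFun y := inl ![1, y]
  map_one' := inl_one_one
  map_mul' u v := by rw [inl_mul_inl, one_mul]

theorem secondCopy_apply {G : Type} [Group G] (y : G) : secondCopy G y = inl ![1, y] := rfl

theorem secondCopy_injective (G : Type) [Group G] : Function.Injective (secondCopy G) :=
  fun _ _ h => congrFun (inl_injective h) 1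

/-- A substitution which lifts words through the second coordinate of `F_x`. -/
def liftWord (x : Fin 3) : FreeGroup (Fin 4) →* FreeGroup (Fin 4) :=
  FreeGroup.lift fun s => if s = 0 then
    FreeGroup.of 0 * FreeGroup.of (![1, 1, 2] x) * FreeGroup.of 0 else FreeGroup.of s

/-- A letter other than `a` already has itself as second coordinate. For `a`, conjugating by the
swap a letter that is not dead brings its first coordinate `a` into second place; `![1, 1, 2] x`
picks such a letter. -/
theorem toWreath_ev_liftWord (x : Fin 3) (H : GrigorchukQuotient) (w : FreeGroup (Fin 4)) :
    ∃ u, toWreath x H ((extension x H).ev (liftWord x w)) = inl ![u, H.ev w] := by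
  have hof : ∀ s, ∃ u, toWreath x H ((extension x H).ev (liftWord x (FreeGroup.of s)))
      = inl ![u, H.ev (FreeGroup.of s)] := fun s => by
    rw [liftWord, FreeGroup.lift_apply_of, ev_of]
    split_ifs with hs
    · subst hs
      have h0 : ![1, 1, 2] x ≠ (0 : Fin 4) := by revert x; decide
      have h1 : ![1, 1, 2] x ≠ dead x := by revert x; decide
      refine ⟨H.letter (![1, 1, 2] x), ?_⟩
      rw [map_mul, map_mul, map_mul, map_mul, ev_of, ev_of, toWreath_a, toWreath_letter _ _ _ h0,
        if_neg h1, inr_swap_mul_inl, mul_assoc, ← map_mul, Equiv.swap_mul_self, map_one, mul_one]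
      rfl
    · exact ⟨_, by rw [ev_of]; exact toWreath_letter x H s hs⟩
  induction w using FreeGroup.induction_on with
  | C1 => exact ⟨1, by rw [map_one, map_one, map_one, map_one, inl_one_one]⟩
  | of s => exact hof s
  | inv_of s _ =>
    obtain ⟨u, hu⟩ := hof s
    exact ⟨u⁻¹, by rw [map_inv, map_inv, map_inv, map_inv, hu, inl_pair_inv]⟩
  | mul v w hv hw =>
    obtain ⟨u, hu⟩ := hv
    obtain ⟨u', hu'⟩ := hw
    exact ⟨u * u', by rw [map_mul, map_mul, map_mul, map_mul, hu, hu', inl_mul_inl]⟩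

theorem toWreath_dead (x : Fin 3) (H : GrigorchukQuotient) :
    toWreath x H ((extension x H).letter (dead x)) = inl ![1, H.letter (dead x)] := by
  rw [toWreath_letter x H _ (dead_ne_zero x), if_pos rfl]

theorem exists_toWreath_eq (x : Fin 3) (H : GrigorchukQuotient) (g : H.carrier) :
    ∃ z u, toWreath x H z = inl ![u, g] := by
  obtain ⟨w, rfl⟩ := H.toMarkedGroup.eval_surjective g
  obtain ⟨u, hu⟩ := toWreath_ev_liftWord x H w
  exact ⟨_, u, hu⟩

section Tail

variable {x : Fin 3} {H : GrigorchukQuotient}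

/-- The elements of `H` whose copy in the second coordinate belongs to `X`. -/
def tail (X : Subgroup (extension x H).carrier) : Subgroup H.carrier :=
  (X.map (toWreath x H)).comap (secondCopy H.carrier)

theorem mem_tail {X : Subgroup (extension x H).carrier} {y : H.carrier} :
    y ∈ tail X ↔ ∃ z ∈ X, toWreath x H z = inl ![1, y] := Iff.rfl

theorem normal_tail {X : Subgroup (extension x H).carrier} (hX : X.Normal) : (tail X).Normal := by
  refine ⟨fun y hy g => ?_⟩
  obtain ⟨z, hz, hzy⟩ := mem_tail.mp hy
  obtain ⟨t, u, ht⟩ := exists_toWreath_eq x H g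
  refine mem_tail.mpr ⟨t * z * t⁻¹, hX.conj_mem z hz t, ?_⟩
  rw [map_mul, map_mul, map_inv, hzy, ht, inl_pair_inv, inl_mul_inl, inl_mul_inl, mul_one,
    mul_inv_cancel]

theorem tail_top_ne_bot (hH : H.IsRobust) : tail (⊤ : Subgroup (extension x H).carrier) ≠ ⊥ := by
  intro h
  have h1 : H.letter (dead x) ∈ tail (⊤ : Subgroup (extension x H).carrier) :=
    mem_tail.mpr ⟨_, trivial, toWreath_dead x H⟩
  rw [h, Subgroup.mem_bot] at h1
  exact hH.letter_ne_one _ (dead_ne_zero x) h1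

theorem commutator_mem {G : Type} [Group G] {X : Subgroup G} (hX : X.Normal) {z : G} (hz : z ∈ X)
    (t : G) : z * t * z⁻¹ * t⁻¹ ∈ X := by
  have h := X.mul_mem hz (hX.conj_mem _ (X.inv_mem hz) t)
  simpa [mul_assoc] using h

/-- The commutator of `(u, v)` with `(1, e)` is `(1, [v, e])`, and robustness supplies an available
`e` that does not commute with `v`. -/
theorem tail_ne_bot_of_mem (hH : H.IsRobust) {X : Subgroup (extension x H).carrier}
    (hX : X.Normal) {z : (extension x H).carrier} (hz : z ∈ X) {u v : H.carrier} (hv : v ≠ 1)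
    (hzv : toWreath x H z = inl ![u, v]) : tail X ≠ ⊥ := by
  obtain ⟨e, he, hve⟩ := hH.exists_not_commute
    (normal_tail (Subgroup.normal_top (G := (extension x H).carrier))) (tail_top_ne_bot hH) hv
  obtain ⟨t, -, ht⟩ := mem_tail.mp he
  intro hbot
  have h : v * e * v⁻¹ * e⁻¹ ∈ tail X := mem_tail.mpr ⟨_, commutator_mem hX hz t, by
    simp [hzv, ht, inl_pair_inv, inl_mul_inl]⟩
  rw [hbot, Subgroup.mem_bot, mul_inv_eq_one, mul_inv_eq_iff_eq_mul] at h
  exact hve h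

theorem tail_ne_bot_of_mem_base (hH : H.IsRobust) {X : Subgroup (extension x H).carrier}
    (hX : X.Normal) {z : (extension x H).carrier} (hz : z ∈ X) (hz1 : z ≠ 1) {u v : H.carrier}
    (hzv : toWreath x H z = inl ![u, v]) : tail X ≠ ⊥ := by
  by_cases hv : v = 1
  · have hu : u ≠ 1 := fun hu => hz1 (toWreath_injective x H (by
      rw [hzv, hu, hv, inl_one_one, map_one]))
    refine tail_ne_bot_of_mem hH hX (hX.conj_mem z hz ((extension x H).letter 0)) (u := v) hu ?_
    rw [map_mul, map_mul, letter_inv, toWreath_a, hzv, inr_swap_mul_inl, mul_assoc, ← map_mul,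
      Equiv.swap_mul_self, map_one, mul_one]
  · exact tail_ne_bot_of_mem hH hX hz hv hzv

theorem tail_ne_bot (hH : H.IsRobust) {X : Subgroup (extension x H).carrier} (hX : X.Normal)
    (hX' : X ≠ ⊥) : tail X ≠ ⊥ := by
  obtain ⟨⟨z, hz⟩, hz1⟩ := Subgroup.ne_bot_iff_exists_ne_one.mp hX'
  replace hz1 : z ≠ 1 := fun h => hz1 (Subtype.ext h)
  obtain ⟨w, hw⟩ := (extension x H).toMarkedGroup.eval_surjective z
  have hzw := (ev_mk (extension x H) w.toWord).symm
  rw [FreeGroup.mk_toWord] at hzw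
  have hz' := toWreath_evalList x H (w.toWord.map Prod.fst)
  rw [hzw.trans hw] at hz'
  revert hz'
  generalize H.evalList (wordSection x (w.toWord.map Prod.fst) false) = u
  generalize H.evalList (wordSection x (w.toWord.map Prod.fst) true) = v
  cases parity (w.toWord.map Prod.fst)
  · intro hz'
    refine tail_ne_bot_of_mem_base hH hX hz hz1 (u := u) (v := v) ?_
    simpa using hz'
  · intro hz'
    -- An element that swaps the coordinates is replaced by its commutator with `(1, e)`, which lies
    -- in the base and has second coordinate `e⁻¹`.
    obtain ⟨⟨e, he⟩, he1⟩ := Subgroup.ne_bot_iff_exists_ne_one.mp (tail_top_ne_bot (x := x) hH)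
    replace he1 : e ≠ 1 := fun h => he1 (Subtype.ext h)
    obtain ⟨t, -, ht⟩ := mem_tail.mp he
    refine tail_ne_bot_of_mem hH hX (commutator_mem hX hz t) (u := u * e * u⁻¹) (v := e⁻¹)
      (inv_ne_one.mpr he1) ?_
    have hs : (inr (Equiv.swap 0 1) : Wreath H.carrier)⁻¹ = inr (Equiv.swap 0 1) := by
      rw [← map_inv, Equiv.swap_inv]
    have hss : (inr (Equiv.swap 0 1) * inr (Equiv.swap 0 1) : Wreath H.carrier) = 1 := by
      rw [← map_mul, Equiv.swap_mul_self, map_one]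
    rw [map_mul, map_mul, map_mul, map_inv, map_inv, hz', if_pos rfl, ht, mul_inv_rev, hs,
      mul_assoc (inl _) (inr _), inr_swap_mul_inl, inl_pair_inv, inl_pair_inv]
    rw [← mul_assoc (inl _), mul_assoc _ (inr _), ← mul_assoc (inr _), hss, one_mul]
    simp [inl_mul_inl]

end Tail

/-- Each nontrivial normal subgroup contains a copy of its tail, a nontrivial normal subgroup of
`H`. Nonamenability and noncommuting pairs are inherited from there. -/
theorem IsRobust.extension (x : Fin 3) {H : GrigorchukQuotient} (hH : H.IsRobust) :
    (extension x H).IsRobust where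
  not_amenable X hX hX' ham := by
    refine hH.not_amenable (tail X) (normal_tail hX) (tail_ne_bot hH hX hX') ?_
    let e := X.equivMapOfInjective _ (toWreath_injective x H)
    refine ham.of_injective (e.symm.toMonoidHom.comp
      (((secondCopy H.carrier).comp (tail X).subtype).codRestrict (X.map (toWreath x H))
        fun y => y.2)) (e.symm.injective.comp fun y y' h => ?_)
    exact Subtype.ext (secondCopy_injective _ (congrArg Subtype.val h))
  not_commute X Y hX hY hX' hY' := by
    obtain ⟨u, hu, v, hv, huv⟩ := hH.not_commute _ _ (normal_tail hX) (normal_tail hY)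
      (tail_ne_bot hH hX hX') (tail_ne_bot hH hY hY')
    obtain ⟨z, hz, hzu⟩ := mem_tail.mp hu
    obtain ⟨t, ht, htv⟩ := mem_tail.mp hv
    refine ⟨z, hz, t, ht, fun h => huv (secondCopy_injective _ ?_)⟩
    rw [map_mul, map_mul, secondCopy_apply, secondCopy_apply, ← hzu, ← htv, ← map_mul, h, map_mul]
  letter_ne_one s hs h := by
    have h1 := toWreath_letter x H s hs
    rw [h, map_one, ← inl_one_one] at h1
    exact hH.letter_ne_one s hs (congrFun (inl_injective h1) 1).symm

theorem IsRobust.iterExtension {H : GrigorchukQuotient} (hH : H.IsRobust) (i : ℕ)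
    (ω : ℕ → Fin 3) : (iterExtension i ω H).IsRobust := by
  induction i generalizing ω with
  | zero => exact hH
  | succ i ih => exact (ih _).extension _

/-- A relation of `H₁` which fails in `H₂` gives one for their extensions. -/
theorem not_ker_extension_le {x : Fin 3} {H₁ H₂ : GrigorchukQuotient} (h₂ : H₂.IsRobust)
    (h : ¬ H₁.ev.ker ≤ H₂.ev.ker) : ¬ (extension x H₁).ev.ker ≤ (extension x H₂).ev.ker := by
  intro hle
  obtain ⟨_, ⟨r, hr, rfl⟩, hcomm⟩ := h₂.exists_not_commute
    (X := H₁.ev.ker.map H₂.ev) (GroupParameter.normal_map_ker _ _)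
    (fun hbot => h ((Subgroup.map_eq_bot_iff _).mp hbot))
    (h₂.letter_ne_one (dead x) (dead_ne_zero x))
  -- The first coordinate of a lifted word is not controlled. A commutator with the dead letter,
  -- whose first coordinate is trivial, removes it.
  have key : ∀ H : GrigorchukQuotient, toWreath x H ((extension x H).ev
      (liftWord x r * FreeGroup.of (dead x) * (liftWord x r)⁻¹ * (FreeGroup.of (dead x))⁻¹))
      = inl ![1, H.ev r * H.letter (dead x) * (H.ev r)⁻¹ * (H.letter (dead x))⁻¹] := fun H => by
    obtain ⟨u, hu⟩ := toWreath_ev_liftWord x H r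
    rw [map_mul, map_mul, map_mul, map_inv, map_inv, map_mul, map_mul, map_mul, map_inv,
      map_inv, hu, ev_of, toWreath_dead]
    simp [inl_pair_inv, inl_mul_inl]
  have h1 := key H₁
  rw [MonoidHom.mem_ker.mp hr] at h1
  simp only [one_mul, inv_one, mul_one, mul_inv_cancel, inl_one_one] at h1
  have h2 := key H₂
  rw [MonoidHom.mem_ker.mp (hle (MonoidHom.mem_ker.mpr
    (toWreath_injective x H₁ (h1.trans (map_one _).symm)))), map_one, ← inl_one_one] at h2
  have h3 := (congrFun (inl_injective h2) 1).symm
  simp only [Matrix.cons_val_one, Matrix.cons_val_fin_one] at h3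
  rw [mul_inv_eq_one, mul_inv_eq_iff_eq_mul] at h3
  exact hcomm h3.symm

end GrigorchukQuotient

namespace DecoratedGroup

open Matrix Complex GrigorchukQuotient

/-! ### Matrices that represent elements of the nonamenable group -/

/-- The inclusion of the nonamenable group into `PSL(2, ℂ)`. -/
def nonamenableToPSL : nonamenableGroup.carrier →* ProjectiveSpecialLinearGroup (Fin 2) ℂ :=
  Subgroup.subtype _

theorem nonamenableToPSL_injective : Function.Injective nonamenableToPSL := Subtype.val_injective

/-- The matrix `A` of determinant one is a lift of `g`. -/
def Represents (g : nonamenableGroup.carrier) (A : Matrix (Fin 2) (Fin 2) ℂ) : Prop :=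
  ∃ h : A.det = 1, nonamenableToPSL g = toPSL A h

theorem exists_represents (g : nonamenableGroup.carrier) : ∃ A, Represents g A := by
  obtain ⟨A, hA⟩ := QuotientGroup.mk_surjective (nonamenableToPSL g)
  exact ⟨A.1, A.2, hA.symm⟩

theorem Represents.ext {g h : nonamenableGroup.carrier} {A : Matrix (Fin 2) (Fin 2) ℂ}
    (hg : Represents g A) (hh : Represents h A) : g = h := by
  obtain ⟨_, hg⟩ := hg
  obtain ⟨_, hh⟩ := hh
  exact nonamenableToPSL_injective (hg.trans hh.symm)

theorem Represents.mul {g h : nonamenableGroup.carrier} {A B : Matrix (Fin 2) (Fin 2) ℂ}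
    (hg : Represents g A) (hh : Represents h B) : Represents (g * h) (A * B) := by
  obtain ⟨dA, hg⟩ := hg
  obtain ⟨dB, hh⟩ := hh
  refine ⟨by rw [det_mul, dA, dB, one_mul], ?_⟩
  rw [map_mul, hg, hh]
  rfl

theorem represents_one : Represents 1 1 := ⟨det_one, rfl⟩

theorem Represents.pow {g : nonamenableGroup.carrier} {A : Matrix (Fin 2) (Fin 2) ℂ}
    (hg : Represents g A) (n : ℕ) : Represents (g ^ n) (A ^ n) := by
  induction n with
  | zero => simpa using represents_one
  | succ n ih => rw [pow_succ, pow_succ]; exact ih.mul hg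

theorem Represents.eq_or_eq_neg {g : nonamenableGroup.carrier} {A B : Matrix (Fin 2) (Fin 2) ℂ}
    (hA : Represents g A) (hB : Represents g B) : B = A ∨ B = -A := by
  obtain ⟨dA, hA⟩ := hA
  obtain ⟨dB, hB⟩ := hB
  have h := QuotientGroup.eq.mp (hA.symm.trans hB)
  obtain ⟨r, hr, hs⟩ := Matrix.SpecialLinearGroup.mem_center_iff.mp h
  have hBA : B = A * scalar (Fin 2) r := by
    rw [hs]
    change B = A * ((⟨A, dA⟩⁻¹ * ⟨B, dB⟩ : SpecialLinearGroup (Fin 2) ℂ) : Matrix _ _ ℂ)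
    have h2 : (⟨A, dA⟩ * (⟨A, dA⟩⁻¹ * ⟨B, dB⟩) : SpecialLinearGroup (Fin 2) ℂ) = ⟨B, dB⟩ :=
      mul_inv_cancel_left _ _
    exact (congrArg Subtype.val h2).symm
  rw [Fintype.card_fin, sq_eq_one_iff] at hr
  rcases hr with rfl | rfl
  · left; simpa using hBA
  · right; rw [hBA, map_neg, map_one, mul_neg, mul_one]

theorem Represents.neg {g : nonamenableGroup.carrier} {A : Matrix (Fin 2) (Fin 2) ℂ}
    (hg : Represents g A) : Represents g (-A) := by
  obtain ⟨dA, hg⟩ := hg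
  have dA' : (-A).det = 1 := by rw [det_neg, dA]; simp
  refine ⟨dA', hg.trans (QuotientGroup.eq.mpr ?_)⟩
  refine Matrix.SpecialLinearGroup.mem_center_iff.mpr ⟨-1, by simp, ?_⟩
  have h2 : (⟨A, dA⟩⁻¹ * ⟨-A, dA'⟩ : SpecialLinearGroup (Fin 2) ℂ) = -1 :=
    inv_mul_eq_iff_eq_mul.mpr (Subtype.ext
      (show -A = A * ((-1 : SpecialLinearGroup (Fin 2) ℂ) : Matrix _ _ ℂ) by simp))
  rw [map_neg, map_one]
  exact (congrArg Subtype.val h2).symm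

theorem Represents.congr {g : nonamenableGroup.carrier} {A B : Matrix (Fin 2) (Fin 2) ℂ}
    (hg : Represents g A) (h : A = B) : Represents g B := h ▸ hg

theorem Represents.eq_one {g : nonamenableGroup.carrier} {A : Matrix (Fin 2) (Fin 2) ℂ}
    (hg : Represents g A) (h : A = 1 ∨ A = -1) : g = 1 := by
  rcases h with rfl | rfl
  · exact hg.ext represents_one
  · exact hg.ext represents_one.neg

theorem Represents.ne_one {g : nonamenableGroup.carrier} {A : Matrix (Fin 2) (Fin 2) ℂ}
    (hg : Represents g A) (h : A 0 1 ≠ 0 ∨ A 1 0 ≠ 0 ∨ A 0 0 ≠ A 1 1) : g ≠ 1 := by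
  rintro rfl
  rcases represents_one.eq_or_eq_neg hg with rfl | rfl <;> simp at h

theorem represents_a : Represents (nonamenableGroup.letter 0) !![I, I / 4; 0, -I] := ⟨_, rfl⟩
theorem represents_b : Represents (nonamenableGroup.letter 1) !![0, I; I, 0] := ⟨_, rfl⟩
theorem represents_c : Represents (nonamenableGroup.letter 2) !![0, 1; -1, 0] := ⟨_, rfl⟩
theorem represents_d : Represents (nonamenableGroup.letter 3) !![I, 0; 0, -I] := ⟨_, rfl⟩

/-- The parabolic element `ad`. -/
def parabolic : nonamenableGroup.carrier := nonamenableGroup.letter 0 * nonamenableGroup.letter 3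

theorem represents_parabolic_pow (n : ℕ) :
    Represents (parabolic ^ n) !![1, -(n / 4 : ℂ); 0, 1] := by
  have h1 : Represents parabolic !![1, -(1 / 4 : ℂ); 0, 1] := by
    refine (represents_a.mul represents_d).neg.congr ?_
    ext i j
    fin_cases i <;> fin_cases j <;> simp
    linear_combination (1 / 4 : ℂ) * I_mul_I
  induction n with
  | zero =>
    rw [pow_zero]
    refine represents_one.congr ?_
    ext i j
    fin_cases i <;> fin_cases j <;> simp
  | succ n ih =>
    rw [pow_succ]
    refine (ih.mul h1).congr ?_
    ext i j
    fin_cases i <;> fin_cases j <;> simp [Matrix.mul_apply, Fin.sum_univ_two]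
    ring

/-! ### Dynamics on the projective line -/

/-- The elements which map the point at infinity into the disc of centre `t` and radius `ρ`. -/
def disc (ρ : ℝ) (t : ℂ) : Set nonamenableGroup.carrier :=
  {g | ∃ A, Represents g A ∧ ‖A 0 0 - t * A 1 0‖ ≤ ρ * ‖A 1 0‖}

theorem Represents.mem_disc {g : nonamenableGroup.carrier} {A : Matrix (Fin 2) (Fin 2) ℂ}
    (hg : Represents g A) {ρ : ℝ} {t : ℂ} :
    g ∈ disc ρ t ↔ ‖A 0 0 - t * A 1 0‖ ≤ ρ * ‖A 1 0‖ := by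
  refine ⟨?_, fun h => ⟨A, hg, h⟩⟩
  rintro ⟨B, hB, h⟩
  rcases hB.eq_or_eq_neg hg with rfl | rfl
  · exact h
  · have h2 : (-B) 0 0 - t * (-B) 1 0 = -(B 0 0 - t * B 1 0) := by
      simp only [Matrix.neg_apply]; ring
    rw [h2, norm_neg, Matrix.neg_apply, norm_neg]
    exact h

theorem one_notMem_disc (ρ : ℝ) (t : ℂ) : (1 : nonamenableGroup.carrier) ∉ disc ρ t := by
  rw [represents_one.mem_disc]
  norm_num

/-- In homogeneous form, a common element would have both entries of its first column equal to zero,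
against determinant one. -/
theorem disjoint_disc {ρ : ℝ} {s t : ℂ} (h : 2 * ρ < ‖s - t‖) : Disjoint (disc ρ s) (disc ρ t) := by
  rw [Set.disjoint_left]
  rintro g ⟨A, hA, h1⟩ h2
  rw [hA.mem_disc] at h2
  have h3 : ‖s - t‖ * ‖A 1 0‖ ≤ 2 * ρ * ‖A 1 0‖ := by
    rw [← norm_mul]
    have h4 : (s - t) * A 1 0 = (A 0 0 - t * A 1 0) - (A 0 0 - s * A 1 0) := by ring
    rw [h4]
    exact (norm_sub_le _ _).trans (by linarith)
  have h5 : A 1 0 = 0 := by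
    by_contra hne
    have := norm_pos_iff.mpr hne
    nlinarith
  rw [h5] at h1
  have h6 : A 0 0 = 0 := by simpa using h1
  obtain ⟨hd, -⟩ := hA
  rw [det_fin_two, h5, h6] at hd
  simp at hd

theorem parabolic_pow_mul_mem_disc {ρ : ℝ} {t : ℂ} {g : nonamenableGroup.carrier} (n : ℕ)
    (hg : g ∈ disc ρ t) : parabolic ^ n * g ∈ disc ρ (t - n / 4) := by
  obtain ⟨A, hA, h⟩ := hg
  have e1 : (!![1, -(n / 4 : ℂ); 0, 1] * A) 1 0 = A 1 0 := by
    simp [Matrix.mul_apply, Fin.sum_univ_two]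
  have e0 : (!![1, -(n / 4 : ℂ); 0, 1] * A) 0 0 = A 0 0 - n / 4 * A 1 0 := by
    simp [Matrix.mul_apply, Fin.sum_univ_two]
    ring
  have e2 : A 0 0 - n / 4 * A 1 0 - (t - n / 4) * A 1 0 = A 0 0 - t * A 1 0 := by ring
  rw [((represents_parabolic_pow n).mul hA).mem_disc, e0, e1, e2]
  exact h

/-- Multiplication by an element which does not fix infinity maps the complement of every large
disc into this disc. -/
theorem exists_absorbing {x : nonamenableGroup.carrier} {M : Matrix (Fin 2) (Fin 2) ℂ}
    (hx : Represents x M) (hM : M 1 0 ≠ 0) :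
    ∃ ρ₀ : ℝ, ∀ ρ ≥ ρ₀, ∀ g, g ∉ disc ρ 0 → x * g ∈ disc ρ 0 := by
  have hr := norm_pos_iff.mpr hM
  -- The bound 1 gives `‖q‖ ≤ ‖p‖` outside the disc; the quotient makes `ρ‖M 1 0‖` dominate the
  -- other three entries.
  refine ⟨max 1 ((‖M 0 0‖ + ‖M 0 1‖ + ‖M 1 1‖) / ‖M 1 0‖), fun ρ hρ g hg => ?_⟩
  obtain ⟨hρ1, hρ2⟩ := max_le_iff.mp hρ
  rw [div_le_iff₀ hr] at hρ2
  obtain ⟨A, hA⟩ := exists_represents g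
  rw [hA.mem_disc, zero_mul, sub_zero, not_le] at hg
  rw [(hx.mul hA).mem_disc, zero_mul, sub_zero]
  simp only [Matrix.mul_apply, Fin.sum_univ_two]
  set p := A 0 0
  set q := A 1 0
  have hq : ‖q‖ ≤ ‖p‖ := by nlinarith [norm_nonneg q]
  have h1 : ‖M 0 0 * p + M 0 1 * q‖ ≤ (‖M 0 0‖ + ‖M 0 1‖) * ‖p‖ := by
    refine (norm_add_le _ _).trans ?_
    rw [norm_mul, norm_mul, add_mul]
    gcongr
  have h2 : ‖M 1 0‖ * ‖p‖ ≤ ‖M 1 0 * p + M 1 1 * q‖ + ‖M 1 1‖ * ‖q‖ := by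
    rw [← norm_mul, ← norm_mul]
    calc ‖M 1 0 * p‖ = ‖(M 1 0 * p + M 1 1 * q) - M 1 1 * q‖ := by rw [add_sub_cancel_right]
      _ ≤ _ := norm_sub_le _ _
  have h3 : (‖M 0 0‖ + ‖M 0 1‖ + ‖M 1 1‖) * ‖p‖ ≤ ρ * ‖M 1 0‖ * ‖p‖ := by gcongr
  have h4 : ρ * (‖M 1 0‖ * ‖p‖) ≤ ρ * (‖M 1 0 * p + M 1 1 * q‖ + ‖M 1 1‖ * ‖q‖) := by gcongr
  have h5 : ‖M 1 1‖ * (ρ * ‖q‖) ≤ ‖M 1 1‖ * ‖p‖ := by gcongr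
  nlinarith

theorem conj_parabolic_absorbing {x : nonamenableGroup.carrier} {ρ : ℝ}
    (hx : ∀ g, g ∉ disc ρ 0 → x * g ∈ disc ρ 0) (n : ℕ) (g : nonamenableGroup.carrier)
    (hg : g ∉ disc ρ (-(n / 4 : ℂ))) :
    parabolic ^ n * x * (parabolic ^ n)⁻¹ * g ∈ disc ρ (-(n / 4 : ℂ)) := by
  have h := parabolic_pow_mul_mem_disc n (hx ((parabolic ^ n)⁻¹ * g) fun h => hg (by
    simpa using parabolic_pow_mul_mem_disc n h))
  simpa [mul_assoc] using h

/-- Conjugation by `c` exchanges the off-diagonal entries up to sign. A nonscalar diagonal matrix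
first acquires an upper right entry by conjugation with `a`. -/
theorem exists_mem_not_fix_infinity {X : Subgroup nonamenableGroup.carrier} (hX : X.Normal)
    (hX' : X ≠ ⊥) : ∃ x ∈ X, ∃ M, Represents x M ∧ M 1 0 ≠ 0 := by
  have key : ∀ x ∈ X, ∀ M, Represents x M → M 0 1 ≠ 0 →
      ∃ x ∈ X, ∃ M, Represents x M ∧ M 1 0 ≠ 0 := fun x hx M hM h => by
    refine ⟨_, hX.conj_mem x hx (nonamenableGroup.letter 2),
      !![0, 1; -1, 0] * M * !![0, 1; -1, 0], ?_, ?_⟩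
    · rw [letter_inv]
      exact (represents_c.mul hM).mul represents_c
    · have e : (!![0, 1; -1, 0] * M * !![0, 1; -1, 0] : Matrix (Fin 2) (Fin 2) ℂ) 1 0
          = M 0 1 := by
        simp only [Matrix.mul_apply, Fin.sum_univ_two]
        simp
      rwa [e]
  obtain ⟨⟨x, hx⟩, hx1⟩ := Subgroup.ne_bot_iff_exists_ne_one.mp hX'
  obtain ⟨M, hM⟩ := exists_represents x
  by_cases h10 : M 1 0 = 0
  · by_cases h01 : M 0 1 = 0
    · have hne : M 0 0 ≠ M 1 1 := fun heq => hx1 (Subtype.ext (hM.eq_one (by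
        obtain ⟨hd, -⟩ := hM
        rw [det_fin_two, h10, h01, ← heq, mul_zero, sub_zero, ← sq, sq_eq_one_iff] at hd
        rcases hd with hd | hd
        · left
          ext i j
          fin_cases i <;> fin_cases j <;> simp [h10, h01, ← heq, hd]
        · right
          ext i j
          fin_cases i <;> fin_cases j <;> simp [h10, h01, ← heq, hd])))
      refine key _ (hX.conj_mem x hx (nonamenableGroup.letter 0))
        (!![I, I / 4; 0, -I] * M * !![I, I / 4; 0, -I]) ?_ ?_
      · rw [letter_inv]
        exact (represents_a.mul hM).mul represents_a
      · have h : (!![I, I / 4; 0, -I] * M * !![I, I / 4; 0, -I] : Matrix (Fin 2) (Fin 2) ℂ) 0 1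
            = (M 1 1 - M 0 0) / 4 := by
          simp only [Matrix.mul_apply, Fin.sum_univ_two, h10, h01]
          simp
          linear_combination (M 0 0 / 4 - M 1 1 / 4) * I_mul_I
        rw [h]
        exact div_ne_zero (sub_ne_zero.mpr hne.symm) (by norm_num)
    · exact key x hx M hM h01
  · exact ⟨x, hx, M, hM, h10⟩

theorem exists_two_mul_lt_norm (ρ : ℝ) : ∃ n : ℕ, 2 * ρ < n / 4 := by
  obtain ⟨n, hn⟩ := exists_nat_gt (8 * ρ)
  exact ⟨n, by linarith⟩

theorem nonamenableGroup_isRobust : nonamenableGroup.IsRobust where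
  not_amenable X hX hX' := by
    obtain ⟨x, hx, M, hM, h10⟩ := exists_mem_not_fix_infinity hX hX'
    obtain ⟨ρ, hρ⟩ := exists_absorbing hM h10
    obtain ⟨n, hn⟩ := exists_two_mul_lt_norm ρ
    -- Powers of the parabolic element translate the plane, so conjugates of `x` by them absorb the
    -- complements of three disjoint translated discs.
    refine not_isAmenableGroup_of_absorbing
      (fun j => Subtype.val ⁻¹' disc ρ (-(((j * n : ℕ) : ℂ) / 4)))
      (fun j => ⟨_, hX.conj_mem x hx (parabolic ^ (j * n : ℕ))⟩) ?_
      fun j g hg => conj_parabolic_absorbing (hρ ρ le_rfl) (j * n) g hg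
    intro i j hij
    refine (disjoint_disc (hn.trans_le ?_)).preimage _
    have h1 : (1 : ℝ) ≤ |(i : ℝ) - j| := by
      have : (1 : ℤ) ≤ |(i : ℤ) - j| := Int.one_le_abs (by omega)
      exact_mod_cast this
    have h2 : (-((((i : ℕ) * n : ℕ) : ℂ) / 4) - -((((j : ℕ) * n : ℕ) : ℂ) / 4))
        = ((-(((i : ℝ) - j) * (n / 4)) : ℝ) : ℂ) := by
      push_cast; ring
    rw [h2, norm_real, norm_neg, Real.norm_eq_abs, abs_mul,
      abs_of_nonneg (by positivity : (0 : ℝ) ≤ n / 4)]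
    exact le_mul_of_one_le_left (by positivity) h1
  not_commute X Y hX hY hX' hY' := by
    obtain ⟨x, hx, M, hM, hM10⟩ := exists_mem_not_fix_infinity hX hX'
    obtain ⟨y, hy, N, hN, hN10⟩ := exists_mem_not_fix_infinity hY hY'
    obtain ⟨ρ₁, h₁⟩ := exists_absorbing hM hM10
    obtain ⟨ρ₂, h₂⟩ := exists_absorbing hN hN10
    replace h₁ := h₁ (max ρ₁ ρ₂) (le_max_left _ _)
    replace h₂ := h₂ (max ρ₁ ρ₂) (le_max_right _ _)
    obtain ⟨n, hn⟩ := exists_two_mul_lt_norm (max ρ₁ ρ₂)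
    replace h₂ := conj_parabolic_absorbing h₂ n
    have hdisj : Disjoint (disc (max ρ₁ ρ₂) 0) (disc (max ρ₁ ρ₂) (-(n / 4 : ℂ))) :=
      disjoint_disc (by simpa using hn)
    -- The identity corresponds to infinity, which is outside both discs. Hence one order of the
    -- product sends it into the first disc and the other order into the second.
    refine ⟨x, hx, _, hY.conj_mem y hy (parabolic ^ n), fun h => ?_⟩
    have hx1 := h₁ 1 (one_notMem_disc _ _)
    have hy1 := h₂ 1 (one_notMem_disc _ _)
    rw [mul_one] at hx1 hy1
    have hxy := h₁ _ (Set.disjoint_right.mp hdisj hy1)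
    have hyx := h₂ _ (Set.disjoint_left.mp hdisj hx1)
    rw [h] at hxy
    exact Set.disjoint_left.mp hdisj hxy hyx
  letter_ne_one s hs := by
    have hcases : s = 1 ∨ s = 2 ∨ s = 3 := by revert s; decide
    rcases hcases with rfl | rfl | rfl
    · exact represents_b.ne_one (by simp)
    · exact represents_c.ne_one (by simp)
    · refine represents_d.ne_one (Or.inr (Or.inr ?_))
      simp [eq_neg_iff_add_eq_zero, ← two_mul]

end DecoratedGroup

namespace DecoratedGroup

open Matrix Complex GrigorchukQuotient SemidirectProduct

/-! ### Relations that separate the groups -/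

theorem pow_four_eq {M : Type*} [Monoid M] (y : M) : y ^ 4 = y * y * (y * y) := by
  rw [← sq, ← sq, ← pow_mul]

/-- The square of the product is `(s, s)`, where `s` is the dead letter of `H`, an involution. -/
theorem pow_four_eq_one_of_extension (x : Fin 3) (H : GrigorchukQuotient) :
    ((extension x H).letter 0 * (extension x H).letter (dead x)) ^ 4 = 1 := by
  apply toWreath_injective
  have hσ : (inr (Equiv.swap 0 1) * inr (Equiv.swap 0 1) : Wreath H.carrier) = 1 := by
    rw [← map_mul, Equiv.swap_mul_self, map_one]
  have h2 : (toWreath x H ((extension x H).letter 0 * (extension x H).letter (dead x))) ^ 2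
      = inl ![H.letter (dead x), H.letter (dead x)] := by
    rw [sq, map_mul, toWreath_a, toWreath_dead]
    nth_rw 1 [inr_swap_mul_inl]
    rw [mul_assoc, ← mul_assoc (inr _), hσ, one_mul, inl_mul_inl, mul_one, one_mul]
  rw [map_pow, pow_four_eq, ← sq (toWreath x H _), h2, map_one, inl_mul_inl, letter_mul_self,
    inl_one_one]

theorem pow_four_ne_one (x : Fin 3) :
    (nonamenableGroup.letter 0 * nonamenableGroup.letter (dead x)) ^ 4 ≠ 1 := by
  have key : ∀ {s : Fin 4} {S M N : Matrix (Fin 2) (Fin 2) ℂ},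
      Represents (nonamenableGroup.letter s) S → !![I, I / 4; 0, -I] * S = M → M * M = N →
      (N * N) 0 1 ≠ 0 → (nonamenableGroup.letter 0 * nonamenableGroup.letter s) ^ 4 ≠ 1 := by
    rintro s S _ _ hS rfl rfl h
    have h4 := (represents_a.mul hS).pow 4
    rw [pow_four_eq (_ * S)] at h4
    exact h4.ne_one (Or.inl h)
  fin_cases x
  · refine key (M := !![-1, 1 / 4; 0, -1]) (N := !![1, -1 / 2; 0, 1]) represents_d ?_ ?_ ?_
    · ext i j
      fin_cases i <;> fin_cases j <;> simp
      linear_combination (-1 / 4 : ℂ) * I_mul_I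
    · ext i j
      fin_cases i <;> fin_cases j <;> norm_num
    · norm_num [Matrix.mul_apply, Fin.sum_univ_two]
  · refine key (M := !![-I / 4, I; I, 0]) (N := !![-17 / 16, 1 / 4; 1 / 4, -1])
      represents_c ?_ ?_ ?_
    · ext i j
      fin_cases i <;> fin_cases j <;> simp
      ring
    · ext i j
      fin_cases i <;> fin_cases j <;> simp
      · linear_combination (1 / 16 : ℂ) * I_mul_I
      · linear_combination (-1 / 4 : ℂ) * I_mul_I
      · linear_combination (-1 / 4 : ℂ) * I_mul_I
    · norm_num [Matrix.mul_apply, Fin.sum_univ_two]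
  · refine key (M := !![-1 / 4, -1; 1, 0]) (N := !![-15 / 16, 1 / 4; -1 / 4, -1])
      represents_b ?_ ?_ ?_
    · ext i j
      fin_cases i <;> fin_cases j <;> simp
      linear_combination (1 / 4 : ℂ) * I_mul_I
    · ext i j
      fin_cases i <;> fin_cases j <;> norm_num
    · norm_num [Matrix.mul_apply, Fin.sum_univ_two]

theorem not_ker_grigorchukGroup_le (ω : ℕ → Fin 3) :
    ¬ (grigorchukGroup ω).ev.ker ≤ nonamenableGroup.ev.ker := by
  intro h
  have h1 : (FreeGroup.of 0 * FreeGroup.of (dead (ω 0))) ^ 4 ∈ (grigorchukGroup ω).ev.ker := by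
    rw [ker_ev_grigorchukGroup, MonoidHom.mem_ker, map_pow, map_mul, ev_of, ev_of]
    exact pow_four_eq_one_of_extension _ _
  have h2 := h h1
  rw [MonoidHom.mem_ker, map_pow, map_mul, ev_of, ev_of] at h2
  exact pow_four_ne_one _ h2

/-- With `u = ad`, the lower unipotent `L = c u¹⁶ c` has entry 16/4 = 4, so `r = u L u` is
antidiagonal and conjugates `u` to `L`. The relation `r u = L r` has odd degree in `a`, since `u`
contains one `a` and `L` contains sixteen. -/
theorem nonamenableGroup_relation :
    parabolic * nonamenableGroup.letter 2 * parabolic ^ 16 * nonamenableGroup.letter 2 * parabolic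
        * parabolic
      = nonamenableGroup.letter 2 * parabolic ^ 16 * nonamenableGroup.letter 2 *
        (parabolic * nonamenableGroup.letter 2 * parabolic ^ 16 * nonamenableGroup.letter 2
          * parabolic) := by
  have hu : Represents parabolic !![1, -(1 / 4 : ℂ); 0, 1] := by
    simpa using represents_parabolic_pow 1
  have hL : Represents (nonamenableGroup.letter 2 * parabolic ^ 16 * nonamenableGroup.letter 2)
      !![1, 0; 4, 1] := by
    refine ((represents_c.mul (represents_parabolic_pow 16)).mul represents_c).neg.congr ?_
    ext i j
    fin_cases i <;> fin_cases j <;> norm_num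
  have hr : Represents (parabolic * nonamenableGroup.letter 2 * parabolic ^ 16 *
      nonamenableGroup.letter 2 * parabolic) !![0, -1 / 4; 4, 0] := by
    rw [mul_assoc parabolic, mul_assoc parabolic]
    refine ((hu.mul hL).mul hu).congr ?_
    ext i j
    fin_cases i <;> fin_cases j <;> norm_num
  refine (hr.mul hu).ext ((hL.mul hr).congr ?_)
  ext i j
  fin_cases i <;> fin_cases j <;> norm_num

/-- The group satisfies a relation in which `a` occurs an odd number of times. -/
theorem not_ker_nonamenableGroup_le (x : Fin 3) (H : GrigorchukQuotient) :
    ¬ nonamenableGroup.ev.ker ≤ (extension x H).ev.ker := by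
  intro h
  let u : FreeGroup (Fin 4) := FreeGroup.of 0 * FreeGroup.of 3
  let c : FreeGroup (Fin 4) := FreeGroup.of 2
  have hrel : nonamenableGroup.ev (u * c * u ^ 16 * c * u * u)
      = nonamenableGroup.ev (c * u ^ 16 * c * (u * c * u ^ 16 * c * u)) := by
    have hu : nonamenableGroup.ev u = parabolic := by
      rw [map_mul, ev_of, ev_of]; rfl
    have hc : nonamenableGroup.ev c = nonamenableGroup.letter 2 := ev_of _ _
    simp only [map_mul, map_pow, hu, hc]
    exact nonamenableGroup_relation
  have h1 := h (show (u * c * u ^ 16 * c * u * u) * (c * u ^ 16 * c * (u * c * u ^ 16 * c * u))⁻¹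
    ∈ nonamenableGroup.ev.ker by rw [MonoidHom.mem_ker, map_mul, map_inv, hrel, mul_inv_cancel])
  let ε : FreeGroup (Fin 4) →* Equiv.Perm (Fin 2) :=
    (rightHom.comp (toWreath x H)).comp (extension x H).ev
  have hε : ∀ s, ε (FreeGroup.of s) = if s = 0 then Equiv.swap 0 1 else 1 := fun s => by
    simp only [ε, MonoidHom.comp_apply, ev_of]
    split_ifs with hs
    · subst hs; rfl
    · rw [toWreath_letter x H s hs, rightHom_inl]
  have h2 : ε ((u * c * u ^ 16 * c * u * u) * (c * u ^ 16 * c * (u * c * u ^ 16 * c * u))⁻¹)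
      = 1 := by
    change rightHom (toWreath x H ((extension x H).ev _)) = 1
    rw [MonoidHom.mem_ker.mp h1, map_one, map_one]
  have hu : ε u = Equiv.swap 0 1 := by rw [map_mul, hε, hε]; rfl
  have hc : ε c = 1 := by rw [hε]; rfl
  have h16 : Equiv.swap (0 : Fin 2) 1 ^ 16 = 1 :=
    (pow_mul _ 2 8).trans (by rw [sq, Equiv.swap_mul_self, one_pow])
  simp only [map_mul, map_inv, map_pow, hu, hc, h16] at h2
  revert h2
  decide

end DecoratedGroup

/-! ### Separation of the iterated extensions -/

namespace DecoratedGroup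

open GrigorchukQuotient

theorem not_ker_grigorchukGroup_le_iterExtension (i : ℕ) (ω : ℕ → Fin 3) :
    ¬ (grigorchukGroup ω).ev.ker ≤ (iterExtension i ω nonamenableGroup).ev.ker := by
  induction i generalizing ω with
  | zero => exact not_ker_grigorchukGroup_le ω
  | succ i ih =>
    rw [ker_ev_grigorchukGroup]
    exact not_ker_extension_le (nonamenableGroup_isRobust.iterExtension i _) (ih _)

/-- After the `i` common extensions are peeled off, the base group is compared with a group that is
still an extension, in which its odd relation fails. -/
theorem not_ker_iterExtension_le {i j : ℕ} (h : i < j) (ω : ℕ → Fin 3) :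
    ¬ (iterExtension i ω nonamenableGroup).ev.ker ≤
      (iterExtension j ω nonamenableGroup).ev.ker := by
  obtain ⟨j, rfl⟩ : ∃ j', j = j' + 1 := ⟨j - 1, by omega⟩
  induction i generalizing j ω with
  | zero => exact not_ker_nonamenableGroup_le _ _
  | succ i ih =>
    obtain ⟨j, rfl⟩ : ∃ j', j = j' + 1 := ⟨j - 1, by omega⟩
    exact not_ker_extension_le (nonamenableGroup_isRobust.iterExtension (j + 1) _)
      (ih _ j (by omega))

/-! ### Relations of the decorated groups -/

theorem mem_ker_markedProduct {I : Type} (G : I → GrigorchukQuotient)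
    (w : FreeGroup (Fin 4)) : w ∈ (markedProduct G).ev.ker ↔ ∀ i, w ∈ (G i).ev.ker := by
  let π : (markedProduct G).carrier →* ∀ i, (G i).carrier := Subgroup.subtype _
  have hπ : Function.Injective π := Subtype.val_injective
  have h : ∀ i, ((Pi.evalMonoidHom _ i).comp π).comp (markedProduct G).ev = (G i).ev := fun i => by
    ext s
    rw [MonoidHom.comp_apply, ev_of, ev_of]
    fin_cases s <;> rfl
  rw [MonoidHom.mem_ker, ← hπ.eq_iff, map_one, funext_iff]
  refine forall_congr' fun i => ?_
  rw [MonoidHom.mem_ker, ← h i]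
  rfl

theorem mem_ker_decoratedGroup (J : Set ℕ) (w : FreeGroup (Fin 4)) :
    w ∈ (decoratedGroup J).eval.ker ↔
      w ∈ (grigorchukGroup word012).ev.ker ∧ ∀ i ∈ J, w ∈ (level i).ev.ker := by
  refine (mem_ker_markedProduct _ w).trans ⟨fun h => ⟨h none, fun i hi => h (some ⟨i, hi⟩)⟩, ?_⟩
  rintro ⟨h0, h⟩ (_ | ⟨i, hi⟩)
  · exact h0
  · exact h i hi

theorem ker_decoratedGroup_anti {J J' : Set ℕ} (h : J ⊆ J') :
    (decoratedGroup J').eval.ker ≤ (decoratedGroup J).eval.ker := fun w hw => by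
  rw [mem_ker_decoratedGroup] at hw ⊢
  exact ⟨hw.1, fun i hi => hw.2 i (h hi)⟩

theorem not_ker_decoratedGroup_le {K : Set ℕ} {m : ℕ} (hK : K ⊆ Iio m) :
    ¬ (decoratedGroup K).eval.ker ≤ (level m).ev.ker := by
  intro hle
  have hrob : (level m).IsRobust := nonamenableGroup_isRobust.iterExtension m _
  -- Replacing `K` by all indices below `m` only shrinks the set of relations and leaves a finite
  -- intersection.
  refine hrob.not_inf_le_ker (N₁ := (grigorchukGroup word012).ev.ker)
    (N₂ := ⨅ i ∈ Finset.range m, (level i).ev.ker) inferInstance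
    (Subgroup.normal_iInf_normal fun i => Subgroup.normal_iInf_normal fun _ => inferInstance)
    (not_ker_grigorchukGroup_le_iterExtension m _)
    (hrob.not_iInf_le_ker (Finset.range m) (fun i => (level i).ev.ker) (fun _ => inferInstance)
      fun i hi => not_ker_iterExtension_le (Finset.mem_range.mp hi) _)
    fun w hw => hle ((mem_ker_decoratedGroup K w).mpr ⟨hw.1, fun i hi => ?_⟩)
  exact Subgroup.mem_iInf.mp (Subgroup.mem_iInf.mp (Subgroup.mem_inf.mp hw).2 i) (Finset.mem_range.mpr (hK hi))

theorem converges_decoratedGroup (K : Set ℕ) :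
    MarkedGroup.Converges (fun n => decoratedGroup (K ∪ Ici n)) (decoratedGroup K) := by
  intro r
  have hω : ∀ k x, ∃ n, word012 (n + k) ≠ x := by
    intro k x
    by_contra! h
    have h0 := congrArg Fin.val ((h 0).trans (h 1).symm)
    simp only [word012, Fin.ofNat] at h0
    omega
  obtain ⟨n₀, hn₀⟩ := eventually_atTop.mp (eventually_ker_grigorchukGroup hω nonamenableGroup r)
  filter_upwards [eventually_ge_atTop n₀] with n hn w hw
  rw [← MonoidHom.mem_ker, ← MonoidHom.mem_ker, mem_ker_decoratedGroup, mem_ker_decoratedGroup]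
  -- The Grigorchuk factor occurs in both groups, so only its own relations matter, and the short
  -- ones hold in every factor of large index.
  refine and_congr_right fun hG => ⟨fun h i hi => h i (Or.inl hi), fun h i hi => ?_⟩
  rcases hi with hi | hi
  · exact h i hi
  · exact hn₀ i (hn.trans hi) w hw hG

/-! ### Strict monotonicity -/

variable {f : GroupParameter}

theorem exists_forall_lt (hf : f.IsStrictlyDecreasing) {K : Set ℕ} {m : ℕ} (hK : K ⊆ Iio m) :
    ∃ n₀, ∀ n ≥ n₀,
      f 4 (decoratedGroup (insert m K)) < f 4 (decoratedGroup (K ∪ Ici n)) := by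
  have hlt : f 4 (decoratedGroup (insert m K)) < f 4 (decoratedGroup K) :=
    hf.lt_of_ker_le (P := (level m).toMarkedGroup) (ker_decoratedGroup_anti (subset_insert m K))
      (fun w hw => ((mem_ker_decoratedGroup _ w).mp hw).2 m (mem_insert m K))
      (nonamenableGroup_isRobust.iterExtension m _).not_amenable (not_ker_decoratedGroup_le hK)
  have hlim := (EReal.coe_lt_coe_iff.mpr hlt).trans_le (hf.1.2 4 _ _ (converges_decoratedGroup K))
  -- The limsup yields a single good index; it serves all later ones, because the sets `K ∪ Ici n`
  -- shrink as `n` grows.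
  obtain ⟨n₀, hn₀⟩ := (frequently_lt_of_lt_limsup (h := hlim)).exists
  refine ⟨n₀, fun n hn => (EReal.coe_lt_coe_iff.mp hn₀).trans_le (hf.1.le_of_ker_le ?_)⟩
  exact ker_decoratedGroup_anti (union_subset_union_right K (Ici_subset_Ici.mpr hn))

theorem exists_gap (hf : f.IsStrictlyDecreasing) (m : ℕ) :
    ∃ μ : ℕ, ∀ K ⊆ Iio m, ∀ n ≥ μ,
      f 4 (decoratedGroup (insert m K)) < f 4 (decoratedGroup (K ∪ Ici n)) := by
  have h := (eventually_all_finite (finite_Iio m).finite_subsets (l := atTop)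
    (p := fun K n => f 4 (decoratedGroup (insert m K)) < f 4 (decoratedGroup (K ∪ Ici n)))).mpr
    fun K hK => eventually_atTop.mpr (exists_forall_lt hf hK)
  obtain ⟨μ, hμ⟩ := eventually_atTop.mp h
  exact ⟨μ, fun K hK n hn => hμ n hn K hK⟩

theorem exists_strictAnti (hf : f.IsStrictlyDecreasing) :
    ∃ μ : ℕ → ℕ, ∀ m : ℕ → ℕ, StrictMono m → (∀ n, μ (m n) < m (n + 1)) →
      StrictAnti fun x : Lex (Set.range m → Bool) => f 4 (decoratedGroup (subsetOf x)) := by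
  choose μ hμ using exists_gap hf
  refine ⟨μ, fun m hm hgap x y hxy => ?_⟩
  obtain ⟨⟨_, j, rfl⟩, heq, hlt⟩ := hxy
  obtain ⟨hx, hy⟩ : ofLex x ⟨m j, j, rfl⟩ = false ∧ ofLex y ⟨m j, j, rfl⟩ = true := by
    simpa using Bool.lt_iff.mp hlt
  -- The two sets agree below `m j`, and the next possible element of `subsetOf x` is `m (j + 1)`,
  -- beyond the gap.
  set K := subsetOf x ∩ Iio (m j)
  have hyK : insert (m j) K ⊆ subsetOf y := by
    refine insert_subset ⟨⟨j, rfl⟩, hy⟩ ?_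
    rintro n ⟨⟨hn, hxn⟩, hnj⟩
    exact ⟨hn, (heq ⟨n, hn⟩ hnj).symm.trans hxn⟩
  have hxK : subsetOf x ⊆ K ∪ Ici (m (j + 1)) := by
    rintro _ ⟨⟨i, rfl⟩, hi⟩
    rcases lt_trichotomy i j with hij | rfl | hij
    · exact Or.inl ⟨⟨⟨i, rfl⟩, hi⟩, hm hij⟩
    · exact absurd (hi.symm.trans hx) (by decide)
    · exact Or.inr (hm.monotone hij)
  calc f 4 (decoratedGroup (subsetOf y)) ≤ f 4 (decoratedGroup (insert (m j) K)) :=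
        hf.1.le_of_ker_le (ker_decoratedGroup_anti hyK)
    _ < f 4 (decoratedGroup (K ∪ Ici (m (j + 1)))) :=
        hμ (m j) K inter_subset_right _ (hgap j).le
    _ ≤ f 4 (decoratedGroup (subsetOf x)) := hf.1.le_of_ker_le (ker_decoratedGroup_anti hxK)

theorem exists_gap_sequence (μ : ℕ → ℕ) :
    ∃ m : ℕ → ℕ, StrictMono m ∧ ∀ n, μ (m n) < m (n + 1) := by
  let m : ℕ → ℕ := fun n => Nat.rec 0 (fun _ k => max k (μ k) + 1) n
  have hm : ∀ n, m (n + 1) = max (m n) (μ (m n)) + 1 := fun _ => rfl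
  exact ⟨m, strictMono_nat_of_lt_succ fun n => by rw [hm]; omega, fun n => by rw [hm]; omega⟩

theorem exists_continuum (hf : f.IsStrictlyDecreasing) :
    ∃ (Ω : Type) (G : Ω → MarkedGroup 4),
      Cardinal.mk (Set.range fun w => f 4 (G w)) = Cardinal.continuum := by
  obtain ⟨μ, hμ⟩ := exists_strictAnti hf
  obtain ⟨m, hm, hgap⟩ := exists_gap_sequence μ
  refine ⟨Lex (Set.range m → Bool), fun x => decoratedGroup (subsetOf x), ?_⟩
  rw [Cardinal.mk_range_eq _ (hμ m hm hgap).injective]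
  have e : Lex (Set.range m → Bool) ≃ (ℕ → Bool) :=
    ofLex.trans ((Equiv.ofInjective m hm.injective).symm.arrowCongr (Equiv.refl Bool))
  rw [Cardinal.mk_congr e]
  simp

end DecoratedGroup

end

theorem lemma1p8 (f : GroupParameter) :
    (f.IsStrictlyMonotone →
      ∃ (Ω : Type) (G : Ω → MarkedGroup 4),
        Cardinal.mk (Set.range fun w => f 4 (G w)) = Cardinal.continuum) ∧
    (f.IsStrictlyDecreasing →
      ∃ μ : ℕ → ℕ, ∀ m : ℕ → ℕ, StrictMono m → (∀ n, 1 ≤ m n) →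
        (∀ n, μ (m n) < m (n + 1)) →
        StrictAnti fun x : Lex (Set.range m → Bool) => f 4 (decoratedGroup (subsetOf x))) ∧
    (f.IsStrictlyIncreasing →
      ∃ μ : ℕ → ℕ, ∀ m : ℕ → ℕ, StrictMono m → (∀ n, 1 ≤ m n) →
        (∀ n, μ (m n) < m (n + 1)) →
        StrictMono fun x : Lex (Set.range m → Bool) => f 4 (decoratedGroup (subsetOf x))) := by
  refine ⟨?_, fun hf => ?_, fun hf => ?_⟩
  · rintro (hf | hf)
    · exact DecoratedGroup.exists_continuum hf
    · obtain ⟨Ω, G, h⟩ := DecoratedGroup.exists_continuum hf.neg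
      refine ⟨Ω, G, ?_⟩
      rw [← h, ← Cardinal.mk_image_eq (neg_injective (G := ℝ)), ← range_comp]
      rfl
  · obtain ⟨μ, h⟩ := DecoratedGroup.exists_strictAnti hf
    exact ⟨μ, fun m hm _ => h m hm⟩
  · obtain ⟨μ, h⟩ := DecoratedGroup.exists_strictAnti hf.neg
    exact ⟨μ, fun m hm _ hgap x y hxy => neg_lt_neg_iff.mp (h m hm hgap hxy)⟩
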